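/- **Model.** Let $n\ge 1$ and $d$ be fixed, let $a^0_1,a^0_2,\dots\in\mathbb R^n$ be nonrandom vectors and $X_0\in\mathbb R^{n\times d}$ a nonrandom matrix. For each sample size $m$ let $A_0$ be the $m\times n$ matrix with rows $(a_i^0)^\top$, $i\le m$, let $C_0=[A_0\;\;A_0X_0]$, and let $C=C_0+\widetilde C$ be the observed matrix, where $\widetilde C=(\delta_{ij})$ is the $m\times(n+d)$ random error matrix, whose rows are the first $m$ terms of a sequence $\tilde c_1,\tilde c_2,\dots$ of random vectors $\tilde c_i=(\delta_{ij})_{j=1}^{n+d}$. Assume that the $\tilde c_i$ are mutually independent, that $\mathbb E\,\delta_{ij}=0$ and $\mathbb E\,\delta_{ij}\delta_{ik}=\Sigma_{jk}$ for all $i\ge1$ and $j,k\le n+d$, with a (possibly singular) matrix $\Sigma$ that does not depend on $i$, and that $\operatorname{rank}\bigl(\Sigma\binom{X_0}{-I_d}\bigr)=d$. **Estimator.** Write $M^\dagger$ for the Moore–Penrose pseudoinverse and $P_\Sigma=\Sigma\Sigma^\dagger$. Let $\Delta\in\mathbb R^{m\times(n+d)}$ minimize $\|\Delta(\Sigma^{1/2})^\dagger\|_F$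 subject to $\Delta(I-P_\Sigma)=0$ and $\operatorname{rank}(C-\Delta)\le n$, and let $\widehat X_{\rm ext}\in\mathbb R^{(n+d)\times d}$ be a matrix of rank $d$ with $(C-\Delta)\widehat X_{\rm ext}=0$. If the lower $d\times d$ block of $\widehat X_{\rm ext}$ is nonsingular, then right multiplication by a nonsingular matrix brings $\widehat X_{\rm ext}$ to the form $\binom{\widehat X}{-I_d}$, and $\widehat X$ is the total least squares (TLS) estimate; otherwise the estimation fails. Thus the TLS estimates are the matrices $\widehat X$ with $(C-\Delta)\binom{\widehat X}{-I_d}=0$ for some minimizer $\Delta$. **Theorem.** Suppose that for some real $r\ge2$ and some integer $m_0\ge1$ $$\sup_{i\ge1,\;1\le j\le n+d}\mathbb E|\delta_{ij}|^{2r}<\infty,\qquad \sum_{m=m_0}^\infty\left(\frac{\sqrt m}{\lambda_{\min}(A_0^\top A_0)}\right)^{r}<\infty,$$ where $\lambda_{\min}$ is the smallest eigenvalue and a term with $\lambda_{\min}(A_0^\top A_0)=0$ counts as $+\infty$. Then the TLS estimator is strongly consistent: $\widehat X\to X_0$ as $m\to\infty$, almost surely. That is, with probability one: for all sufficiently large $m$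 a TLS estimate exists and the estimation does not fail for any choice of $\Delta$ and $\widehat X_{\rm ext}$; and every sequence $(\widehat X_m)$ such that $\widehat X_m$ is a TLS estimate for sample size $m$ for all sufficiently large $m$ converges to $X_0$. -/

import Mathlib

open MeasureTheory ProbabilityTheory Filter Topology

/-- The four Penrose equations: `G` is the Moore-Penrose pseudoinverse of the real matrix `A`. -/
structure IsMoorePenrose {k l : Type*} [Fintype k] [Fintype l]
    (A : Matrix k l ℝ) (G : Matrix l k ℝ) : Prop where
  mul_mul_self : A * G * A = A
  self_mul_mul : G * A * G = G
  symm_left : (A * G).transpose = A * G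
  symm_right : (G * A).transpose = G * A

theorem IsMoorePenrose.unique {k l : Type*} [Fintype k] [Fintype l]
    {A : Matrix k l ℝ} {G H : Matrix l k ℝ}
    (hG : IsMoorePenrose A G) (hH : IsMoorePenrose A H) : G = H := by
  have h1 : A * G = A * H := by
    calc A * G = (A * H * A) * G := by rw [hH.mul_mul_self]
      _ = (A * H).transpose * (A * G).transpose := by
          rw [hH.symm_left, hG.symm_left]; simp only [Matrix.mul_assoc]
      _ = ((A * G * A) * H).transpose := by
          rw [← Matrix.transpose_mul]; simp only [Matrix.mul_assoc]
      _ = A * H := by rw [hG.mul_mul_self, hH.symm_left]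
  have h2 : G * A = H * A := by
    calc G * A = G * (A * H * A) := by rw [hH.mul_mul_self]
      _ = (G * A).transpose * (H * A).transpose := by
          rw [hH.symm_right, hG.symm_right]; simp only [Matrix.mul_assoc]
      _ = (H * (A * G * A)).transpose := by
          rw [← Matrix.transpose_mul]; simp only [Matrix.mul_assoc]
      _ = H * A := by rw [hG.mul_mul_self, hH.symm_right]
  calc G = G * A * G := hG.self_mul_mul.symm
    _ = H * A * G := by rw [h2]
    _ = H * (A * H) := by rw [Matrix.mul_assoc, h1]
    _ = H := by rw [← Matrix.mul_assoc, hH.self_mul_mul]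

theorem exists_isMoorePenrose_of_isHermitian {l : Type*} [Fintype l] [DecidableEq l]
    {M : Matrix l l ℝ} (hM : M.IsHermitian) :
    ∃ G : Matrix l l ℝ, IsMoorePenrose M G ∧ G.transpose = G := by
  obtain ⟨U, D, hU, hMU⟩ : ∃ (U : Matrix l l ℝ) (D : l → ℝ),
      U.transpose * U = 1 ∧ M = U * Matrix.diagonal D * U.transpose := by
    refine ⟨hM.eigenvectorUnitary, hM.eigenvalues, ?_, ?_⟩
    · have := (Matrix.mem_unitaryGroup_iff' (A := (hM.eigenvectorUnitary : Matrix l l ℝ))).1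
        hM.eigenvectorUnitary.2
      simpa [Matrix.star_eq_conjTranspose, Matrix.conjTranspose_eq_transpose_of_trivial] using this
    · have := hM.spectral_theorem
      rw [Unitary.conjStarAlgAut_apply] at this
      simpa [Matrix.star_eq_conjTranspose, Matrix.conjTranspose_eq_transpose_of_trivial,
        Function.comp_def] using this
  have key : ∀ a b : l → ℝ, U * Matrix.diagonal a * U.transpose *
      (U * Matrix.diagonal b * U.transpose) =
      U * Matrix.diagonal (fun i => a i * b i) * U.transpose := by
    intro a b
    calc _ = U * Matrix.diagonal a * (U.transpose * U) * Matrix.diagonal b * U.transpose := by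
          simp only [Matrix.mul_assoc]
      _ = _ := by rw [hU, Matrix.mul_one, Matrix.mul_assoc U, Matrix.diagonal_mul_diagonal]
  have keyT : ∀ a : l → ℝ, (U * Matrix.diagonal a * U.transpose).transpose =
      U * Matrix.diagonal a * U.transpose := by
    intro a
    simp [Matrix.transpose_mul, Matrix.mul_assoc]
  refine ⟨U * Matrix.diagonal (fun i => (D i)⁻¹) * U.transpose, ⟨?_, ?_, ?_, ?_⟩, keyT _⟩
  · rw [hMU, key, key]
    exact congrArg (fun a : l → ℝ => U * Matrix.diagonal a * U.transpose)
      (funext fun i => mul_inv_mul_cancel (D i))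
  · rw [hMU, key, key]
    exact congrArg (fun a : l → ℝ => U * Matrix.diagonal a * U.transpose)
      (funext fun i => by simpa using mul_inv_mul_cancel (D i)⁻¹)
  · rw [hMU, key, keyT]
  · rw [hMU, key, keyT]

theorem exists_isMoorePenrose {k l : Type*} [Fintype k] [Fintype l]
    (A : Matrix k l ℝ) : ∃ G : Matrix l k ℝ, IsMoorePenrose A G := by
  classical
  have hM : (A.transpose * A).IsHermitian := by
    simpa [Matrix.conjTranspose_eq_transpose_of_trivial] using
      Matrix.isHermitian_conjTranspose_mul_self A
  obtain ⟨G, hG, hGs⟩ := exists_isMoorePenrose_of_isHermitian hM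
  refine ⟨G * A.transpose, ⟨?_, ?_, ?_, ?_⟩⟩
  · have h0 : (A * (G * (A.transpose * A) - 1)).transpose *
        (A * (G * (A.transpose * A) - 1)) = 0 := by
      have : A.transpose * A * (G * (A.transpose * A) - 1) = 0 := by
        rw [Matrix.mul_sub, ← Matrix.mul_assoc (A.transpose * A) G, hG.mul_mul_self,
          Matrix.mul_one, sub_self]
      rw [Matrix.transpose_mul, Matrix.mul_assoc, ← Matrix.mul_assoc A.transpose, this,
        Matrix.mul_zero]
    have h1 : A * (G * (A.transpose * A) - 1) = 0 := by
      rw [← Matrix.conjTranspose_eq_transpose_of_trivial] at h0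
      exact Matrix.conjTranspose_mul_self_eq_zero.1 h0
    rw [Matrix.mul_sub, Matrix.mul_one, sub_eq_zero] at h1
    simpa only [Matrix.mul_assoc] using h1
  · have := congrArg (· * A.transpose) hG.self_mul_mul
    simpa only [Matrix.mul_assoc] using this
  · simp only [Matrix.transpose_mul, Matrix.transpose_transpose, hGs, Matrix.mul_assoc]
  · simpa only [Matrix.mul_assoc] using hG.symm_right

/-- The Moore-Penrose pseudoinverse of a real matrix. -/
noncomputable def pinv {k l : Type*} [Fintype k] [Fintype l] (A : Matrix k l ℝ) :
    Matrix l k ℝ :=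
  (exists_isMoorePenrose A).choose

theorem pinv_spec {k l : Type*} [Fintype k] [Fintype l] (A : Matrix k l ℝ) :
    IsMoorePenrose A (pinv A) :=
  (exists_isMoorePenrose A).choose_spec

/-- The smallest eigenvalue of a real symmetric matrix (of positive size). -/
noncomputable def lambdaMin {k : Type*} [Fintype k] [DecidableEq k] (M : Matrix k k ℝ) : ℝ :=
  sInf (spectrum ℝ M)

open scoped MatrixOrder in
/-- The positive semidefinite square root of a positive semidefinite real matrix. -/
noncomputable def psdSqrt {k : Type*} [Fintype k] [DecidableEq k] (S : Matrix k k ℝ) :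
    Matrix k k ℝ :=
  CFC.sqrt S

open scoped MatrixOrder in
theorem psdSqrt_spec {k : Type*} [Fintype k] [DecidableEq k] {S : Matrix k k ℝ}
    (hS : S.PosSemidef) : (psdSqrt S).PosSemidef ∧ psdSqrt S * psdSqrt S = S :=
  ⟨Matrix.nonneg_iff_posSemidef.1 (CFC.sqrt_nonneg S),
    CFC.sqrt_mul_sqrt_self S (Matrix.nonneg_iff_posSemidef.2 hS)⟩

/-- The orthogonal projector onto the column space of `S`. -/
noncomputable def colProj {k : Type*} [Fintype k] (S : Matrix k k ℝ) : Matrix k k ℝ :=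
  S * pinv S

/-- The Frobenius norm. -/
noncomputable def frobNorm {k l : Type*} [Fintype k] [Fintype l] (M : Matrix k l ℝ) : ℝ :=
  √(∑ i, ∑ j, M i j ^ 2)

section TLS

variable {n d : ℕ}

/-- The `m × n` matrix `A₀` of true regressors; its rows are the first `m` vectors of the
sequence `a0` (which is indexed from `0`). -/
def trueA (a0 : ℕ → Fin n → ℝ) (m : ℕ) : Matrix (Fin m) (Fin n) ℝ :=
  Matrix.of fun i : Fin m => a0 i

/-- The `m × (n + d)` matrix `C₀ = [A₀  A₀ X₀]` of true variables. -/
def trueC (a0 : ℕ → Fin n → ℝ) (X0 : Matrix (Fin n) (Fin d) ℝ) (m : ℕ) :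
    Matrix (Fin m) (Fin n ⊕ Fin d) ℝ :=
  Matrix.fromCols (trueA a0 m) (trueA a0 m * X0)

/-- The `m × (n + d)` matrix of observations, `C = C₀ + (δ i j)`. -/
def obsC {Ω : Type*} (a0 : ℕ → Fin n → ℝ) (X0 : Matrix (Fin n) (Fin d) ℝ)
    (δ : ℕ → Ω → (Fin n ⊕ Fin d) → ℝ) (m : ℕ) (ω : Ω) :
    Matrix (Fin m) (Fin n ⊕ Fin d) ℝ :=
  trueC a0 X0 m + Matrix.of fun i : Fin m => δ i ω

/-- The augmented `(n + d) × d` matrix with upper block `X` and lower block `-I`. -/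
def augment (X : Matrix (Fin n) (Fin d) ℝ) : Matrix (Fin n ⊕ Fin d) (Fin d) ℝ :=
  Matrix.fromRows X (-1)

/-- The constraint set of the TLS problem. -/
def tlsFeasible {m : ℕ} (S : Matrix (Fin n ⊕ Fin d) (Fin n ⊕ Fin d) ℝ)
    (C : Matrix (Fin m) (Fin n ⊕ Fin d) ℝ) : Set (Matrix (Fin m) (Fin n ⊕ Fin d) ℝ) :=
  {Δ | Δ * (1 - colProj S) = 0 ∧ (C - Δ).rank ≤ n}

/-- `Δ` attains the constrained minimum in the TLS problem for the data `C` and the error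
covariance `S`. -/
def IsTLSMinimizer {m : ℕ} (S : Matrix (Fin n ⊕ Fin d) (Fin n ⊕ Fin d) ℝ)
    (C Δ : Matrix (Fin m) (Fin n ⊕ Fin d) ℝ) : Prop :=
  Δ ∈ tlsFeasible S C ∧
    ∀ Δ' ∈ tlsFeasible S C, frobNorm (Δ * pinv (psdSqrt S)) ≤ frobNorm (Δ' * pinv (psdSqrt S))

/-- `(Δ, Y)` is a possible outcome of the first step of TLS estimation: `Δ` is a minimizer, and
the columns of `Y` are `d` linearly independent vectors orthogonal to the rows of `C - Δ`. -/
def IsTLSPair {m : ℕ} (S : Matrix (Fin n ⊕ Fin d) (Fin n ⊕ Fin d) ℝ)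
    (C Δ : Matrix (Fin m) (Fin n ⊕ Fin d) ℝ) (Y : Matrix (Fin n ⊕ Fin d) (Fin d) ℝ) : Prop :=
  IsTLSMinimizer S C Δ ∧ (C - Δ) * Y = 0 ∧ Y.rank = d

/-- `X` is a value of the TLS estimator: `(C - Δ) * (X; -I) = 0` for some minimizer `Δ`. -/
def IsTLSEstimate {m : ℕ} (S : Matrix (Fin n ⊕ Fin d) (Fin n ⊕ Fin d) ℝ)
    (C : Matrix (Fin m) (Fin n ⊕ Fin d) ℝ) (X : Matrix (Fin n) (Fin d) ℝ) : Prop :=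
  ∃ Δ, IsTLSMinimizer S C Δ ∧ (C - Δ) * augment X = 0

end TLS

/-! Write `C = A P + E` with `P = regMap X0 = [I X₀]`. Since `P * augment X = X - X₀`, consistency
says that `P` is nearly zero on the vectors killed by `C - Δ`.

The deterministic core compares the minimizer with an oracle. Let `Z` be a basis of the column space
of `augment X0`, normalized by `ZᵀSZ = 1`. The correction `E Z Zᵀ S` is feasible and costs `‖EZ‖²`,
which is about `m d` because `EᵀE` is close to `m S`. If `Y` is killed by `C - Δ` and `YᵀSY = 1`,
then `CY = ΔY = (Δ R†)(R Y)` with `R = S^{1/2}`, and `R Y` has orthonormal columns, so `‖CY‖²` is at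
most the optimal cost. Expanding `CY = A P Y + E Y` bounds `‖CY‖²` below by `m d` plus about
`(λ/2)‖PY‖²`, where `λ` is the smallest eigenvalue of `AᵀA`. The two terms `m d` cancel. What
remains is `‖PY‖² ≤ K η`, where `η` measures the errors relative to `λ` as in `SmallError`. A
singular `S` does no harm: `S` is definite on the kernel of `P` by the rank hypothesis, so `|Pv|² +
vᵀSv` is a definite form (`exists_normSq_le`). The main results here are `exists_regMap_mul_le` and
`exists_tls_bound`.

The probabilistic part shows that almost surely every `η > 0` is eventually admissible. The entries
of `EᵀE - m S` are sums of `m` independent centered variables with bounded `r`-th moments. Their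
`r`-th moments are `O(m^{r/2})`, so by Markov the probability of exceeding `ελ` is `O((√m/λ)^r)`.
After factoring `A = U V` with `UᵀU = 1`, the entries of `UᵀE` have bounded `2r`-th moments and
exceed `ε√λ` with probability `O(λ^{-r})`. Both bounds are summable, and Borel–Cantelli applies. The
moment inequality is `exists_integral_abs_sum_rpow_le`. -/

/-! ### Quadratic forms, Frobenius norms and rank -/

section LinearAlgebra

open Matrix

variable {k l p : Type*} [Fintype k] [Fintype l] [Fintype p]

/-- `T = G^{-1/2}`. With `G = YᵀSY` it replaces a basis `Y` by one that is orthonormal for the form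
`S`; with `G = AᵀA` it orthonormalizes the columns of `A`. -/
theorem Matrix.PosDef.exists_normalizer [DecidableEq k] {G : Matrix k k ℝ} (hG : G.PosDef) :
    ∃ T : Matrix k k ℝ, Tᵀ = T ∧ IsUnit T ∧ T * G * T = 1 := by
  have hdet : IsUnit G.det := (Matrix.isUnit_iff_isUnit_det G).1 hG.isUnit
  obtain ⟨h1, h2⟩ := psdSqrt_spec hG.inv.posSemidef
  set T := psdSqrt G⁻¹
  have h3 : T * (T * G) = 1 := by
    rw [← Matrix.mul_assoc, h2, Matrix.nonsing_inv_mul _ hdet]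
  have hT : Tᵀ = T := by
    simpa [conjTranspose_eq_transpose_of_trivial] using h1.isHermitian.eq
  exact ⟨T, hT, IsUnit.of_mul_eq_one _ h3, mul_eq_one_comm.1 h3⟩

theorem lambdaMin_mul_dotProduct_le [DecidableEq k] {M : Matrix k k ℝ} (hM : M.IsHermitian)
    (v : k → ℝ) : lambdaMin M * (v ⬝ᵥ v) ≤ v ⬝ᵥ M *ᵥ v := by
  obtain ⟨U, hU, hMU⟩ : ∃ (U : Matrix k k ℝ),
      U * Uᵀ = 1 ∧ M = U * Matrix.diagonal hM.eigenvalues * Uᵀ := by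
    refine ⟨hM.eigenvectorUnitary, ?_, ?_⟩
    · have := (Matrix.mem_unitaryGroup_iff (A := (hM.eigenvectorUnitary : Matrix k k ℝ))).1
        hM.eigenvectorUnitary.2
      simpa [Matrix.star_eq_conjTranspose, conjTranspose_eq_transpose_of_trivial] using this
    · have := hM.spectral_theorem
      rw [Unitary.conjStarAlgAut_apply] at this
      simpa [Matrix.star_eq_conjTranspose, conjTranspose_eq_transpose_of_trivial,
        Function.comp_def] using this
  have h1 : v ⬝ᵥ M *ᵥ v = ∑ i, hM.eigenvalues i * ((Uᵀ *ᵥ v) i) ^ 2 := by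
    conv_lhs => rw [hMU]
    rw [Matrix.mul_assoc, ← mulVec_mulVec, dotProduct_mulVec, ← mulVec_transpose,
      ← mulVec_mulVec, dotProduct]
    refine Finset.sum_congr rfl fun i _ => ?_
    rw [mulVec_diagonal]; ring
  have h2 : v ⬝ᵥ v = ∑ i, ((Uᵀ *ᵥ v) i) ^ 2 := by
    have : v ⬝ᵥ v = (Uᵀ *ᵥ v) ⬝ᵥ (Uᵀ *ᵥ v) := by
      rw [dotProduct_mulVec, vecMul_transpose, mulVec_mulVec, hU, one_mulVec]
    rw [this, dotProduct]
    exact Finset.sum_congr rfl fun i _ => by ring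
  rw [h1, h2, Finset.mul_sum]
  refine Finset.sum_le_sum fun i _ => mul_le_mul_of_nonneg_right ?_ (sq_nonneg _)
  rw [lambdaMin, hM.spectrum_real_eq_range_eigenvalues]
  exact csInf_le (Set.finite_range _).bddBelow ⟨i, rfl⟩

theorem lambdaMin_pos [DecidableEq k] [Nonempty k] {M : Matrix k k ℝ} (hM : M.PosDef) :
    0 < lambdaMin M := by
  rw [lambdaMin, hM.isHermitian.spectrum_real_eq_range_eigenvalues]
  obtain ⟨i, hi⟩ := (Set.range_nonempty hM.isHermitian.eigenvalues).csInf_mem (Set.finite_range _)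
  rw [← hi]
  exact hM.eigenvalues_pos i

theorem frobNorm_sq (M : Matrix k l ℝ) : frobNorm M ^ 2 = (Mᵀ * M).trace := by
  rw [frobNorm, Real.sq_sqrt (by positivity), Finset.sum_comm]
  simp [trace, mul_apply, sq]

theorem frobNorm_nonneg (M : Matrix k l ℝ) : 0 ≤ frobNorm M := Real.sqrt_nonneg _

theorem frobNorm_mul_transpose_of_isometry [DecidableEq p] (W : Matrix k p ℝ) {Q : Matrix l p ℝ}
    (hQ : Qᵀ * Q = 1) : frobNorm (W * Qᵀ) ^ 2 = frobNorm W ^ 2 := by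
  rw [frobNorm_sq, frobNorm_sq, transpose_mul, transpose_transpose, Matrix.mul_assoc,
    trace_mul_comm, Matrix.mul_assoc, Matrix.mul_assoc, hQ, Matrix.mul_one]

theorem frobNorm_mul_le_of_isometry [DecidableEq p] (W : Matrix k l ℝ) {Q : Matrix l p ℝ}
    (hQ : Qᵀ * Q = 1) : frobNorm (W * Q) ^ 2 ≤ frobNorm W ^ 2 := by
  classical
  -- Pythagoras for the orthogonal projector `Q Qᵀ`.
  have h : frobNorm (W * (1 - Q * Qᵀ)) ^ 2 = frobNorm W ^ 2 - frobNorm (W * Q) ^ 2 := by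
    have hT : (1 - Q * Qᵀ)ᵀ = 1 - Q * Qᵀ := by simp
    have hI : (1 - Q * Qᵀ) * (1 - Q * Qᵀ) = 1 - Q * Qᵀ := by
      have : Q * Qᵀ * (Q * Qᵀ) = Q * Qᵀ := by
        rw [Matrix.mul_assoc, ← Matrix.mul_assoc Qᵀ, hQ, Matrix.one_mul]
      rw [Matrix.mul_sub, Matrix.sub_mul, Matrix.sub_mul, this]; simp
    have hc : ∀ (A : Matrix k l ℝ) (B : Matrix l p ℝ),
      ((A * B)ᵀ * (A * B)).trace = (Aᵀ * A * (B * Bᵀ)).trace := by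
      intro A B
      rw [transpose_mul, Matrix.mul_assoc, trace_mul_comm]; simp only [Matrix.mul_assoc]
    have hc' : ((W * (1 - Q * Qᵀ))ᵀ * (W * (1 - Q * Qᵀ))).trace =
        (Wᵀ * W * ((1 - Q * Qᵀ) * (1 - Q * Qᵀ)ᵀ)).trace := by
      rw [transpose_mul, Matrix.mul_assoc, trace_mul_comm]; simp only [Matrix.mul_assoc]
    rw [frobNorm_sq, frobNorm_sq, frobNorm_sq, hc, hc', hT, hI, Matrix.mul_sub, trace_sub,
      Matrix.mul_one]
  nlinarith [sq_nonneg (frobNorm (W * (1 - Q * Qᵀ)))]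

/-- The squared Frobenius norm as a sum over columns. -/
theorem frobNorm_sq_eq_sum_col (M : Matrix k l ℝ) :
    frobNorm M ^ 2 = ∑ j, M.col j ⬝ᵥ M.col j := by
  rw [frobNorm_sq]; rfl

theorem dotProduct_mulVec_self_le (M : Matrix k l ℝ) (w : l → ℝ) :
    M *ᵥ w ⬝ᵥ M *ᵥ w ≤ frobNorm M ^ 2 * (w ⬝ᵥ w) := by
  rw [frobNorm, Real.sq_sqrt (by positivity), dotProduct, Finset.sum_mul]
  refine Finset.sum_le_sum fun i _ => ?_
  have := Finset.sum_mul_sq_le_sq_mul_sq Finset.univ (M i) w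
  simpa [mulVec, dotProduct, sq] using this

theorem dotProduct_transpose_mul_self (M : Matrix k l ℝ) (v : l → ℝ) :
    v ⬝ᵥ (Mᵀ * M) *ᵥ v = M *ᵥ v ⬝ᵥ M *ᵥ v := by
  rw [← mulVec_mulVec, dotProduct_mulVec, vecMul_transpose]

theorem dotProduct_self_nonneg' (v : k → ℝ) : 0 ≤ v ⬝ᵥ v :=
  Finset.sum_nonneg fun i _ => mul_self_nonneg (v i)

/-- A matrix of rank at most `n` with `n + d` columns kills `d` independent vectors. -/
theorem exists_mul_eq_zero_of_rank_le {κ : Type*} {n d : ℕ} (M : Matrix κ (Fin n ⊕ Fin d) ℝ)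
    (hM : M.rank ≤ n) : ∃ Y : Matrix (Fin n ⊕ Fin d) (Fin d) ℝ, M * Y = 0 ∧ Y.rank = d := by
  have h := LinearMap.finrank_range_add_finrank_ker M.mulVecLin
  rw [← Matrix.rank] at h
  have hd : d ≤ Module.finrank ℝ (LinearMap.ker M.mulVecLin) := by
    simp at h; omega
  obtain ⟨f, hf⟩ := exists_linearIndependent_of_le_finrank hd
  refine ⟨Matrix.of fun i j => (f j : (Fin n ⊕ Fin d) → ℝ) i, ?_, ?_⟩
  · ext i j
    have := (f j).2
    rw [LinearMap.mem_ker] at this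
    exact congrFun this i
  · have h2 : LinearIndependent ℝ (fun j => (f j : (Fin n ⊕ Fin d) → ℝ)) :=
      hf.map' (LinearMap.ker M.mulVecLin).subtype (Submodule.ker_subtype _)
    have := LinearIndependent.rank_matrix
      (M := Matrix.of fun j i => (f j : (Fin n ⊕ Fin d) → ℝ) i) h2
    rw [Fintype.card_fin, ← rank_transpose] at this
    exact this

theorem rank_le_of_mul_eq_zero {κ : Type*} {n d : ℕ} {M : Matrix κ (Fin n ⊕ Fin d) ℝ}
    {Y : Matrix (Fin n ⊕ Fin d) (Fin d) ℝ} (hMY : M * Y = 0) (hY : Y.rank = d) :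
    M.rank ≤ n := by
  have h := LinearMap.finrank_range_add_finrank_ker M.mulVecLin
  rw [← Matrix.rank] at h
  have h2 : LinearMap.range Y.mulVecLin ≤ LinearMap.ker M.mulVecLin := by
    rintro _ ⟨w, rfl⟩
    simp [mulVec_mulVec, hMY]
  have h3 := Submodule.finrank_mono h2
  rw [← Matrix.rank, hY] at h3
  simp at h; omega

theorem mulVec_eq_zero_of_rank_eq {κ : Type*} {d : ℕ} {Y : Matrix κ (Fin d) ℝ} (hY : Y.rank = d)
    {u : Fin d → ℝ} (hu : Y *ᵥ u = 0) : u = 0 := by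
  have h := LinearMap.finrank_range_add_finrank_ker Y.mulVecLin
  rw [← Matrix.rank, hY] at h
  simp at h
  have : u ∈ LinearMap.ker Y.mulVecLin := hu
  simpa [h] using this

theorem rank_eq_of_mulVec_eq_zero {κ : Type*} {d : ℕ} {Y : Matrix κ (Fin d) ℝ}
    (hY : ∀ u, Y *ᵥ u = 0 → u = 0) : Y.rank = d := by
  have h := LinearMap.finrank_range_add_finrank_ker Y.mulVecLin
  have : LinearMap.ker Y.mulVecLin = ⊥ := LinearMap.ker_eq_bot'.2 hY
  rw [← Matrix.rank, this] at h
  simpa using h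

/-- Rank is lower semicontinuous: having rank at least `n + 1` is an open condition. -/
theorem isClosed_setOf_rank_le (n : ℕ) : IsClosed {M : Matrix k l ℝ | M.rank ≤ n} := by
  classical
  let Φ : Matrix k l ℝ →ₗ[ℝ] ((l → ℝ) →L[ℝ] (k → ℝ)) :=
    LinearMap.toContinuousLinearMap.toLinearMap ∘ₗ (Matrix.toLin').toLinearMap
  have hΦ : Continuous Φ := Φ.continuous_of_finiteDimensional
  have := (isOpen_setOfPred_nat_le_rank (𝕜 := ℝ) (E := l → ℝ) (F := k → ℝ) (n := n + 1)).preimage hΦ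
  rw [← isOpen_compl_iff]
  convert this using 1
  ext M
  have : (Φ M : (l → ℝ) →ₗ[ℝ] (k → ℝ)) = M.mulVecLin := by
    ext; simp [Φ]
  simp only [Set.mem_compl_iff, Set.mem_ofPred_eq, Set.mem_preimage, this, not_le]
  rw [LinearMap.rank, ← Module.finrank_eq_rank, Matrix.rank]
  exact_mod_cast Iff.rfl

end LinearAlgebra

/-! ### The pseudoinverse of the square root of the covariance -/

section Pseudoinverse

open Matrix

variable {k : Type*} [Fintype k] [DecidableEq k] {S : Matrix k k ℝ}

theorem psdSqrt_transpose (hS : S.PosSemidef) : (psdSqrt S)ᵀ = psdSqrt S := by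
  simpa [conjTranspose_eq_transpose_of_trivial] using (psdSqrt_spec hS).1.isHermitian.eq

theorem Matrix.PosSemidef.transpose_eq {κ : Type*} {M : Matrix κ κ ℝ} (hS : M.PosSemidef) :
    Mᵀ = M := by
  simpa [conjTranspose_eq_transpose_of_trivial] using hS.isHermitian.eq

theorem dotProduct_mulVec_psdSqrt (hS : S.PosSemidef) (v : k → ℝ) :
    v ⬝ᵥ S *ᵥ v = psdSqrt S *ᵥ v ⬝ᵥ psdSqrt S *ᵥ v := by
  rw [← dotProduct_transpose_mul_self, psdSqrt_transpose hS, (psdSqrt_spec hS).2]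

theorem psdSqrt_mul_mul_pinv (hS : S.PosSemidef) :
    psdSqrt S * psdSqrt S * pinv (psdSqrt S) = psdSqrt S := by
  have h := pinv_spec (psdSqrt S)
  have h1 := congrArg transpose h.mul_mul_self
  rwa [transpose_mul, h.symm_left, psdSqrt_transpose hS, ← Matrix.mul_assoc] at h1

/-- The constraint puts the rows of `D` in the range of `S`, which lies in the range of `S^{1/2}`,
and `R†R` fixes that range. Hence `D` is recovered from the matrix `D R†` whose norm is minimized.
-/
theorem mul_pinv_psdSqrt_mul {κ : Type*} (hS : S.PosSemidef) {D : Matrix κ k ℝ}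
    (hD : D * (1 - colProj S) = 0) : D * pinv (psdSqrt S) * psdSqrt S = D := by
  rw [Matrix.mul_sub, Matrix.mul_one, sub_eq_zero] at hD
  have h := pinv_spec (psdSqrt S)
  have h2 : colProj S = (pinv S)ᵀ * S := by
    have := (pinv_spec S).symm_left
    rw [transpose_mul, hS.transpose_eq] at this
    exact this.symm
  rw [h2] at hD
  have h3 : S * pinv (psdSqrt S) * psdSqrt S = S := by
    have := congrArg (psdSqrt S * ·) h.mul_mul_self
    simpa only [← Matrix.mul_assoc, (psdSqrt_spec hS).2] using this
  calc D * pinv (psdSqrt S) * psdSqrt S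
      = D * (pinv S)ᵀ * (S * pinv (psdSqrt S) * psdSqrt S) := by
        conv_lhs => rw [hD]
        simp only [Matrix.mul_assoc]
    _ = D := by rw [h3, Matrix.mul_assoc, ← hD]

theorem mul_mul_one_sub_colProj {κ : Type*} (hS : S.PosSemidef) (M : Matrix κ k ℝ) :
    M * S * (1 - colProj S) = 0 := by
  have h := pinv_spec S
  have h1 := congrArg transpose h.mul_mul_self
  rw [transpose_mul, h.symm_left, hS.transpose_eq] at h1
  rw [Matrix.mul_sub, Matrix.mul_one, Matrix.mul_assoc, colProj, h1, sub_self]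

end Pseudoinverse

/-! ### Deterministic error bound for the TLS estimate -/

section Deterministic

open Matrix

variable {n d : ℕ}

theorem isCompact_setOf_frobNorm_le {k l : Type*} [Fintype k] [Fintype l] (c : ℝ) :
    IsCompact {W : Matrix k l ℝ | frobNorm W ≤ c} := by
  have hK : IsCompact (Set.univ.pi fun _ : k => Set.univ.pi fun _ : l => Set.Icc (-c) c) :=
    isCompact_univ_pi fun _ => isCompact_univ_pi fun _ => isCompact_Icc
  refine hK.of_isClosed_subset (isClosed_le ?_ continuous_const) ?_
  · unfold frobNorm
    fun_prop
  · intro W hW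
    simp only [Set.mem_univ_pi]
    intro i j
    rw [Set.mem_Icc, ← abs_le]
    refine le_trans ?_ hW
    refine Real.abs_le_sqrt ?_
    calc W i j ^ 2 ≤ ∑ j, W i j ^ 2 :=
          Finset.single_le_sum (f := fun j => W i j ^ 2) (fun _ _ => sq_nonneg _)
            (Finset.mem_univ j)
      _ ≤ _ := Finset.single_le_sum (f := fun i => ∑ j, W i j ^ 2)
            (fun _ _ => Finset.sum_nonneg fun _ _ => sq_nonneg _) (Finset.mem_univ i)

theorem exists_isTLSMinimizer {m : ℕ} {S : Matrix (Fin n ⊕ Fin d) (Fin n ⊕ Fin d) ℝ}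
    (hS : S.PosSemidef) {C : Matrix (Fin m) (Fin n ⊕ Fin d) ℝ} (hne : (tlsFeasible S C).Nonempty) :
    ∃ D, IsTLSMinimizer S C D := by
  obtain ⟨D₀, hD₀⟩ := hne
  let f : Matrix (Fin m) (Fin n ⊕ Fin d) ℝ → ℝ := fun D => frobNorm (D * pinv (psdSqrt S))
  have hf : Continuous f := by
    change Continuous fun D => frobNorm (D * pinv (psdSqrt S))
    unfold frobNorm
    fun_prop
  have hcl : IsClosed (tlsFeasible S C ∩ {D | f D ≤ f D₀}) := by
    refine IsClosed.inter (IsClosed.inter ?_ ?_) (isClosed_le hf continuous_const)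
    · exact isClosed_eq (by fun_prop) continuous_const
    · exact (isClosed_setOf_rank_le n).preimage (f := fun D => C - D) (by fun_prop)
  -- The cost controls only `D R†`. Since `D = (D R†) R` on the feasible set, the sublevel set lies
  -- in the image of a Frobenius ball under right multiplication by `R`.
  have hcomp : IsCompact (tlsFeasible S C ∩ {D | f D ≤ f D₀}) := by
    refine ((isCompact_setOf_frobNorm_le (f D₀)).image
      (f := fun W : Matrix (Fin m) (Fin n ⊕ Fin d) ℝ => W * psdSqrt S)
      (by fun_prop)).of_isClosed_subset hcl ?_
    rintro D ⟨hD, hDf⟩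
    exact ⟨D * pinv (psdSqrt S), hDf, mul_pinv_psdSqrt_mul hS hD.1⟩
  obtain ⟨D, hD, hmin⟩ := hcomp.exists_isMinOn ⟨D₀, hD₀, le_refl (f D₀)⟩ hf.continuousOn
  refine ⟨D, hD.1, fun D' hD' => ?_⟩
  rcases le_total (f D') (f D₀) with h | h
  · exact hmin ⟨hD', h⟩
  · exact le_trans hD.2 h

/-- Regressors and errors for which the errors are small relative to the level `lam` of the
regressors. -/
structure SmallError {m : ℕ} (S : Matrix (Fin n ⊕ Fin d) (Fin n ⊕ Fin d) ℝ)
    (A : Matrix (Fin m) (Fin n) ℝ) (E : Matrix (Fin m) (Fin n ⊕ Fin d) ℝ) (lam η : ℝ) :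
    Prop where
  lower : ∀ x, lam * (x ⬝ᵥ x) ≤ A *ᵥ x ⬝ᵥ A *ᵥ x
  gram : ∀ v, |E *ᵥ v ⬝ᵥ E *ᵥ v - m * (v ⬝ᵥ S *ᵥ v)| ≤ η * lam * (v ⬝ᵥ v)
  cross : ∀ x, Eᵀ *ᵥ (A *ᵥ x) ⬝ᵥ Eᵀ *ᵥ (A *ᵥ x) ≤ η ^ 2 * lam * (A *ᵥ x ⬝ᵥ A *ᵥ x)

/-- The map whose kernel is the column space of `augment X0`. -/
def regMap (X0 : Matrix (Fin n) (Fin d) ℝ) : Matrix (Fin n) (Fin n ⊕ Fin d) ℝ :=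
  Matrix.fromCols 1 X0

theorem trueC_eq (a0 : ℕ → Fin n → ℝ) (X0 : Matrix (Fin n) (Fin d) ℝ) (m : ℕ) :
    trueC a0 X0 m = trueA a0 m * regMap X0 := by
  rw [trueC, regMap, mul_fromCols, Matrix.mul_one]

theorem regMap_mul_augment (X0 X : Matrix (Fin n) (Fin d) ℝ) :
    regMap X0 * augment X = X - X0 := by
  rw [regMap, augment, fromCols_mul_fromRows]
  simp [sub_eq_add_neg]

theorem eq_neg_augment_mulVec_of_regMap_eq_zero {X0 : Matrix (Fin n) (Fin d) ℝ}
    {v : Fin n ⊕ Fin d → ℝ} (hv : regMap X0 *ᵥ v = 0) :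
    v = augment X0 *ᵥ (-(v ∘ Sum.inr)) := by
  rw [regMap, fromCols_mulVec, one_mulVec] at hv
  rw [augment, fromRows_mulVec]
  ext (i | i)
  · have := congrFun hv i
    simp only [Pi.add_apply, Function.comp, Pi.zero_apply] at this
    simp only [Sum.elim_inl, mulVec_neg, Pi.neg_apply]
    exact eq_neg_of_add_eq_zero_left this
  · simp [neg_mulVec]

theorem augment_mulVec_eq_zero {X : Matrix (Fin n) (Fin d) ℝ} {u : Fin d → ℝ}
    (h : augment X *ᵥ u = 0) : u = 0 := by
  rw [augment, fromRows_mulVec] at h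
  ext i
  simpa [neg_mulVec] using congrFun h (Sum.inr i)

theorem augment_rank (X : Matrix (Fin n) (Fin d) ℝ) : (augment X).rank = d :=
  rank_eq_of_mulVec_eq_zero fun _ hu => augment_mulVec_eq_zero hu

theorem transpose_mul_mul_isHermitian {k l : Type*} [Fintype k] [Fintype l]
    {S : Matrix k k ℝ} (hS : Sᵀ = S) (Y : Matrix k l ℝ) : (Yᵀ * S * Y).IsHermitian := by
  rw [IsHermitian, conjTranspose_eq_transpose_of_trivial]
  simp [transpose_mul, hS, Matrix.mul_assoc]

theorem dotProduct_transpose_mul_mul {k l : Type*} [Fintype k] [Fintype l]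
    (S : Matrix k k ℝ) (Y : Matrix k l ℝ) (u : l → ℝ) :
    u ⬝ᵥ (Yᵀ * S * Y) *ᵥ u = Y *ᵥ u ⬝ᵥ S *ᵥ (Y *ᵥ u) := by
  rw [Matrix.mul_assoc, ← mulVec_mulVec, dotProduct_mulVec, vecMul_transpose, mulVec_mulVec]

theorem mulVec_eq_zero_of_form_eq_zero {k : Type*} [Fintype k] [DecidableEq k] {S : Matrix k k ℝ}
    (hS : S.PosSemidef) {v : k → ℝ} (hv : v ⬝ᵥ S *ᵥ v = 0) : psdSqrt S *ᵥ v = 0 := by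
  rw [dotProduct_mulVec_psdSqrt hS] at hv
  exact dotProduct_self_eq_zero.1 hv

theorem form_nonneg {k : Type*} [Fintype k] {S : Matrix k k ℝ}
    (hS : S.PosSemidef) (v : k → ℝ) : 0 ≤ v ⬝ᵥ S *ᵥ v := by
  simpa using hS.dotProduct_mulVec_nonneg v

theorem posDef_transpose_mul_mul {k l : Type*} [Fintype k] [Fintype l] {S : Matrix k k ℝ}
    (hS : S.PosSemidef) {Y : Matrix k l ℝ}
    (hY : ∀ u, Y *ᵥ u ⬝ᵥ S *ᵥ (Y *ᵥ u) = 0 → u = 0) : (Yᵀ * S * Y).PosDef := by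
  classical
  refine PosDef.of_dotProduct_mulVec_pos (transpose_mul_mul_isHermitian hS.transpose_eq Y) ?_
  intro u hu
  rw [star_trivial, dotProduct_transpose_mul_mul]
  exact lt_of_le_of_ne (form_nonneg hS _) fun h => hu (hY u h.symm)

variable {S : Matrix (Fin n ⊕ Fin d) (Fin n ⊕ Fin d) ℝ} {X0 : Matrix (Fin n) (Fin d) ℝ}

theorem eq_zero_of_form_augment_eq_zero (hS : S.PosSemidef) (hrank : (S * augment X0).rank = d)
    {u : Fin d → ℝ} (hu : augment X0 *ᵥ u ⬝ᵥ S *ᵥ (augment X0 *ᵥ u) = 0) : u = 0 := by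
  refine mulVec_eq_zero_of_rank_eq hrank ?_
  rw [← mulVec_mulVec, ← (psdSqrt_spec hS).2, ← mulVec_mulVec,
    mulVec_eq_zero_of_form_eq_zero hS hu, mulVec_zero]

/-- The form on the right is definite: a null vector lies in the kernel of `regMap X0`, which is the
column space of `augment X0`, and `S` is definite there by the rank condition. The constant is the
inverse of the smallest eigenvalue. -/
theorem exists_normSq_le (hn : 1 ≤ n) (hS : S.PosSemidef) (hrank : (S * augment X0).rank = d) :
    ∃ c : ℝ, 0 < c ∧ ∀ v, v ⬝ᵥ v ≤
      c * (regMap X0 *ᵥ v ⬝ᵥ regMap X0 *ᵥ v + v ⬝ᵥ S *ᵥ v) := by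
  have : Nonempty (Fin n ⊕ Fin d) := ⟨Sum.inl ⟨0, hn⟩⟩
  have hform : ∀ v, v ⬝ᵥ ((regMap X0)ᵀ * regMap X0 + S) *ᵥ v =
      regMap X0 *ᵥ v ⬝ᵥ regMap X0 *ᵥ v + v ⬝ᵥ S *ᵥ v := by
    intro v
    rw [add_mulVec, dotProduct_add, dotProduct_transpose_mul_self]
  have hF : ((regMap X0)ᵀ * regMap X0 + S).PosDef := by
    refine PosDef.of_dotProduct_mulVec_pos ?_ ?_
    · rw [IsHermitian, conjTranspose_eq_transpose_of_trivial]
      simp [transpose_mul, hS.transpose_eq]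
    · intro v hv
      rw [star_trivial, hform]
      have h1 := dotProduct_self_nonneg' (regMap X0 *ᵥ v)
      have h2 := form_nonneg hS v
      refine lt_of_le_of_ne (by positivity) fun h => hv ?_
      have h3 : regMap X0 *ᵥ v ⬝ᵥ regMap X0 *ᵥ v = 0 := by linarith
      have h4 : v ⬝ᵥ S *ᵥ v = 0 := by linarith
      have h5 := eq_neg_augment_mulVec_of_regMap_eq_zero (dotProduct_self_eq_zero.1 h3)
      rw [h5] at h4
      rw [h5, eq_zero_of_form_augment_eq_zero hS hrank h4, mulVec_zero]
  have hpos := lambdaMin_pos hF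
  refine ⟨(lambdaMin ((regMap X0)ᵀ * regMap X0 + S))⁻¹, inv_pos.2 hpos, fun v => ?_⟩
  rw [← hform, inv_mul_eq_div, le_div_iff₀ hpos, mul_comm]
  exact lambdaMin_mul_dotProduct_le hF.isHermitian v

/-- Expand `|Ax + Ev|²` with `x = Pv`. The cross term costs at most `η|Ax|² + ηλ|v|²` and replacing
`|Ev|²` by `m vᵀSv` costs `ηλ|v|²`. Then `|v|² ≤ c(|x|² + vᵀSv)` and `η(1 + 2c) ≤ 1/2` leave half of
`λ|x|²`. -/
theorem SmallError.le_obs {m : ℕ} {A : Matrix (Fin m) (Fin n) ℝ}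
    {E : Matrix (Fin m) (Fin n ⊕ Fin d) ℝ} {lam η c : ℝ} (h : SmallError S A E lam η)
    (hlam : 0 < lam) (hη : 0 < η) (hc0 : 0 < c)
    (hc : ∀ v, v ⬝ᵥ v ≤ c * (regMap X0 *ᵥ v ⬝ᵥ regMap X0 *ᵥ v + v ⬝ᵥ S *ᵥ v))
    (hηc : η * (1 + 2 * c) ≤ 1 / 2) (v : Fin n ⊕ Fin d → ℝ) :
    m * (v ⬝ᵥ S *ᵥ v) + lam * (1 / 2 * (regMap X0 *ᵥ v ⬝ᵥ regMap X0 *ᵥ v)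
      - 2 * η * c * (v ⬝ᵥ S *ᵥ v)) ≤
      (A * regMap X0 + E) *ᵥ v ⬝ᵥ (A * regMap X0 + E) *ᵥ v := by
  set x := regMap X0 *ᵥ v
  set y := Eᵀ *ᵥ (A *ᵥ x)
  have e1 : (A * regMap X0 + E) *ᵥ v = A *ᵥ x + E *ᵥ v := by
    rw [add_mulVec, ← mulVec_mulVec]
  have e2 : A *ᵥ x ⬝ᵥ E *ᵥ v = y ⬝ᵥ v := by
    rw [dotProduct_mulVec, ← mulVec_transpose]
  rw [e1, add_dotProduct, dotProduct_add, dotProduct_add, dotProduct_comm (E *ᵥ v), e2]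
  have h1 := h.lower x
  have h2 := (abs_le.1 (h.gram v)).1
  have h3 := h.cross x
  have h4 := hc v
  have hx := dotProduct_self_nonneg' x
  -- Young's inequality with weight `ηλ`, matched to the bound `|y|² ≤ η²λ|Ax|²`.
  have h5 : 0 ≤ (y + (η * lam) • v) ⬝ᵥ (y + (η * lam) • v) := dotProduct_self_nonneg' _
  rw [add_dotProduct, dotProduct_add, dotProduct_add, dotProduct_comm (_ • v) y] at h5
  simp only [dotProduct_smul, smul_dotProduct, smul_eq_mul] at h5
  have hηl : 0 < η * lam := mul_pos hη hlam
  have h6 : -(η * (A *ᵥ x ⬝ᵥ A *ᵥ x) + η * lam * (v ⬝ᵥ v)) ≤ 2 * (y ⬝ᵥ v) := by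
    have h7 : 0 ≤ (η * lam) * (η * (A *ᵥ x ⬝ᵥ A *ᵥ x) + η * lam * (v ⬝ᵥ v) + 2 * (y ⬝ᵥ v)) := by
      have : y ⬝ᵥ y ≤ η ^ 2 * lam * (A *ᵥ x ⬝ᵥ A *ᵥ x) := h3
      nlinarith
    have := (mul_nonneg_iff_of_pos_left hηl).1 h7
    linarith
  have hη1 : 0 ≤ 1 - η := by
    by_contra hcon
    nlinarith [mul_pos hη hc0]
  have h8 : (1 - η) * (lam * (x ⬝ᵥ x)) ≤ (1 - η) * (A *ᵥ x ⬝ᵥ A *ᵥ x) :=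
    mul_le_mul_of_nonneg_left h1 hη1
  have h9 : 2 * (η * lam) * (v ⬝ᵥ v) ≤ 2 * (η * lam) * (c * (x ⬝ᵥ x + v ⬝ᵥ S *ᵥ v)) :=
    mul_le_mul_of_nonneg_left h4 (by positivity)
  have h10 : lam * (x ⬝ᵥ x) * (η * (1 + 2 * c)) ≤ lam * (x ⬝ᵥ x) * (1 / 2) :=
    mul_le_mul_of_nonneg_left hηc (by positivity)
  nlinarith

/-- Sum over the columns of `Y`. Each has `vᵀSv = 1`, so the leading term is `m d` whatever `Y` is;
this is what lets it cancel against the oracle cost. -/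
theorem trace_add_le_frobNorm_obs {m : ℕ} {A : Matrix (Fin m) (Fin n) ℝ}
    {E : Matrix (Fin m) (Fin n ⊕ Fin d) ℝ} {lam η c : ℝ} (h : SmallError S A E lam η)
    (hlam : 0 < lam) (hη : 0 < η) (hc0 : 0 < c)
    (hc : ∀ v, v ⬝ᵥ v ≤ c * (regMap X0 *ᵥ v ⬝ᵥ regMap X0 *ᵥ v + v ⬝ᵥ S *ᵥ v))
    (hηc : η * (1 + 2 * c) ≤ 1 / 2) {Y : Matrix (Fin n ⊕ Fin d) (Fin d) ℝ}
    (hY : Yᵀ * S * Y = 1) :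
    m * d + lam * (1 / 2 * frobNorm (regMap X0 * Y) ^ 2 - 2 * η * c * d) ≤
      frobNorm ((A * regMap X0 + E) * Y) ^ 2 := by
  have hcol : ∀ {κ : Type} [Fintype κ] (M : Matrix κ (Fin n ⊕ Fin d) ℝ) (j : Fin d),
      (M * Y).col j = M *ᵥ Y.col j := fun M j => rfl
  have hone : ∀ j, Y.col j ⬝ᵥ S *ᵥ Y.col j = 1 := by
    intro j
    have := congrFun (congrFun hY j) j
    rw [one_apply_eq, Matrix.mul_assoc] at this
    exact this
  rw [frobNorm_sq_eq_sum_col, frobNorm_sq_eq_sum_col]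
  have := Finset.sum_le_sum fun (j : Fin d) (_ : j ∈ Finset.univ) =>
    h.le_obs hlam hη hc0 hc hηc (Y.col j)
  simp only [hone, mul_one] at this
  refine le_trans (le_of_eq ?_) this
  simp only [hcol, Finset.sum_add_distrib, Finset.sum_const, Finset.card_univ, Fintype.card_fin,
    ← Finset.mul_sum, Finset.sum_sub_distrib, nsmul_eq_mul]
  ring

theorem SmallError.frobNorm_error_mul_le {m : ℕ} {A : Matrix (Fin m) (Fin n) ℝ}
    {E : Matrix (Fin m) (Fin n ⊕ Fin d) ℝ} {lam η : ℝ} (h : SmallError S A E lam η)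
    {Z : Matrix (Fin n ⊕ Fin d) (Fin d) ℝ} (hZ : Zᵀ * S * Z = 1) :
    frobNorm (E * Z) ^ 2 ≤ m * d + lam * (η * frobNorm Z ^ 2) := by
  have hone : ∀ j, Z.col j ⬝ᵥ S *ᵥ Z.col j = 1 := by
    intro j
    have := congrFun (congrFun hZ j) j
    rw [one_apply_eq, Matrix.mul_assoc] at this
    exact this
  rw [frobNorm_sq_eq_sum_col, frobNorm_sq_eq_sum_col]
  calc ∑ j, (E * Z).col j ⬝ᵥ (E * Z).col j
      ≤ ∑ j, (m + η * lam * (Z.col j ⬝ᵥ Z.col j)) := by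
        refine Finset.sum_le_sum fun j _ => ?_
        have := (abs_le.1 (h.gram (Z.col j))).2
        rw [hone] at this
        change E *ᵥ Z.col j ⬝ᵥ E *ᵥ Z.col j ≤ _
        linarith
    _ = _ := by
        rw [Finset.sum_add_distrib, ← Finset.mul_sum, Finset.sum_const, Finset.card_univ,
          Fintype.card_fin, nsmul_eq_mul]
        ring

/-- The correction of the data that makes the true parameter solve the corrected system. -/
theorem oracle_mem_tlsFeasible {m : ℕ} (hS : S.PosSemidef) (A : Matrix (Fin m) (Fin n) ℝ)
    (E : Matrix (Fin m) (Fin n ⊕ Fin d) ℝ) {T : Matrix (Fin d) (Fin d) ℝ} (hTu : IsUnit T)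
    (hT : (augment X0 * T)ᵀ * S * (augment X0 * T) = 1) :
    E * (augment X0 * T) * (augment X0 * T)ᵀ * S ∈ tlsFeasible S (A * regMap X0 + E) := by
  refine ⟨mul_mul_one_sub_colProj hS _, rank_le_of_mul_eq_zero (Y := augment X0 * T) ?_ ?_⟩
  -- With `Z = augment X0 * T`, the true part of the data kills `Z`, and the correction maps `Z` to
  -- `E Z (ZᵀSZ) = E Z`.
  · rw [Matrix.sub_mul, Matrix.add_mul, Matrix.mul_assoc A, ← Matrix.mul_assoc (regMap X0),
      regMap_mul_augment, sub_self, Matrix.zero_mul, Matrix.mul_zero, zero_add, Matrix.mul_assoc,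
      Matrix.mul_assoc (E * (augment X0 * T)), ← Matrix.mul_assoc _ S, hT, Matrix.mul_one,
      sub_self]
  · rw [rank_mul_eq_left_of_isUnit_det _ _ ((isUnit_iff_isUnit_det T).1 hTu), augment_rank]

theorem oracle_cost {m : ℕ} (hS : S.PosSemidef)
    (E : Matrix (Fin m) (Fin n ⊕ Fin d) ℝ) {Z : Matrix (Fin n ⊕ Fin d) (Fin d) ℝ}
    (hZ : Zᵀ * S * Z = 1) :
    frobNorm (E * Z * Zᵀ * S * pinv (psdSqrt S)) ^ 2 = frobNorm (E * Z) ^ 2 := by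
  have hR := psdSqrt_mul_mul_pinv hS
  rw [(psdSqrt_spec hS).2] at hR
  have : E * Z * Zᵀ * S * pinv (psdSqrt S) = E * Z * (psdSqrt S * Z)ᵀ := by
    rw [Matrix.mul_assoc _ S, hR, transpose_mul, psdSqrt_transpose hS, Matrix.mul_assoc (E * Z)]
  rw [this, frobNorm_mul_transpose_of_isometry]
  rw [transpose_mul, psdSqrt_transpose hS, Matrix.mul_assoc, ← Matrix.mul_assoc (psdSqrt S),
    (psdSqrt_spec hS).2, ← Matrix.mul_assoc, hZ]

theorem exists_regMap_mul_le (hn : 1 ≤ n) (hS : S.PosSemidef)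
    (hrank : (S * augment X0).rank = d) :
    ∃ K η₀ : ℝ, 0 < K ∧ 0 < η₀ ∧ ∀ (m : ℕ) (A : Matrix (Fin m) (Fin n) ℝ)
      (E : Matrix (Fin m) (Fin n ⊕ Fin d) ℝ) (lam η : ℝ), 0 < lam → 0 < η → η ≤ η₀ →
      SmallError S A E lam η →
      (∃ D, IsTLSMinimizer S (A * regMap X0 + E) D) ∧
      ∀ D Y, IsTLSPair S (A * regMap X0 + E) D Y → ∀ u,
        regMap X0 *ᵥ (Y *ᵥ u) ⬝ᵥ regMap X0 *ᵥ (Y *ᵥ u) ≤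
          K * η * (Y *ᵥ u ⬝ᵥ S *ᵥ (Y *ᵥ u)) := by
  obtain ⟨c, hc0, hc⟩ := exists_normSq_le hn hS hrank
  have hG0 : ((augment X0)ᵀ * S * augment X0).PosDef :=
    posDef_transpose_mul_mul hS fun u hu => eq_zero_of_form_augment_eq_zero hS hrank hu
  obtain ⟨T₀, hT₀s, hT₀u, hT₀⟩ := hG0.exists_normalizer
  have hZ : (augment X0 * T₀)ᵀ * S * (augment X0 * T₀) = 1 := by
    rw [transpose_mul, hT₀s, ← hT₀]; simp only [Matrix.mul_assoc]
  -- The first constant comes from solving the comparison for `‖PY‖²`, with `+ 1` to keep it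
  -- positive when `d = 0`; the second ensures `η(1 + 2c) ≤ 1/2`.
  refine ⟨2 * (2 * c * d + frobNorm (augment X0 * T₀) ^ 2) + 1, (2 * (1 + 2 * c))⁻¹,
    by positivity, by positivity, ?_⟩
  intro m A E lam η hlam hη hη₀ hE
  have hfeas := oracle_mem_tlsFeasible (X0 := X0) hS A E hT₀u hZ
  refine ⟨exists_isTLSMinimizer hS ⟨_, hfeas⟩, ?_⟩
  rintro D Y ⟨⟨hDf, hDmin⟩, hDY, hYr⟩
  have hηc : η * (1 + 2 * c) ≤ 1 / 2 := by
    have := mul_le_mul_of_nonneg_right hη₀ (show 0 ≤ 1 + 2 * c by positivity)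
    rwa [mul_inv, mul_assoc, inv_mul_cancel₀ (by positivity), mul_one, ← one_div] at this
  have hDR := mul_pinv_psdSqrt_mul hS hDf.1
  have hobs : ∀ w, (A * regMap X0 + E) *ᵥ (Y *ᵥ w) = D *ᵥ (Y *ᵥ w) := by
    intro w
    rw [Matrix.sub_mul, sub_eq_zero] at hDY
    rw [mulVec_mulVec, hDY, ← mulVec_mulVec]
  -- If `v = Yu` is null for `S`, then `Rv = 0`, so `Cv = Dv = D R† R v = 0`. The lower bound on
  -- `|Cv|²` then forces `Pv = 0`, hence `v = 0`.
  have hG : (Yᵀ * S * Y).PosDef := by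
    refine posDef_transpose_mul_mul hS fun u hu => ?_
    have h1 := mulVec_eq_zero_of_form_eq_zero hS hu
    have h2 := hobs u
    rw [← hDR, ← mulVec_mulVec, h1, mulVec_zero] at h2
    have h3 := hE.le_obs hlam hη hc0 hc hηc (Y *ᵥ u)
    rw [h2, hu, dotProduct_zero] at h3
    have h4 := hc (Y *ᵥ u)
    have h5 := dotProduct_self_nonneg' (regMap X0 *ᵥ (Y *ᵥ u))
    have h6 : regMap X0 *ᵥ (Y *ᵥ u) ⬝ᵥ regMap X0 *ᵥ (Y *ᵥ u) = 0 := by nlinarith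
    rw [h6, hu, add_zero, mul_zero] at h4
    have h7 := dotProduct_self_eq_zero.1 (le_antisymm h4 (dotProduct_self_nonneg' _))
    exact mulVec_eq_zero_of_rank_eq hYr h7
  obtain ⟨T, hTs, hTu, hT⟩ := hG.exists_normalizer
  have hYT : (Y * T)ᵀ * S * (Y * T) = 1 := by
    rw [transpose_mul, hTs, ← hT]; simp only [Matrix.mul_assoc]
  have h1 := trace_add_le_frobNorm_obs hE hlam hη hc0 hc hηc hYT
  have h2 := hE.frobNorm_error_mul_le hZ
  have h3 : frobNorm ((A * regMap X0 + E) * (Y * T)) ^ 2 ≤ frobNorm (D * pinv (psdSqrt S)) ^ 2 := by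
    have hQ : (psdSqrt S * (Y * T))ᵀ * (psdSqrt S * (Y * T)) = 1 := by
      rw [transpose_mul, psdSqrt_transpose hS, Matrix.mul_assoc, ← Matrix.mul_assoc (psdSqrt S),
        (psdSqrt_spec hS).2, ← Matrix.mul_assoc, hYT]
    have := frobNorm_mul_le_of_isometry (D * pinv (psdSqrt S)) hQ
    rw [← Matrix.mul_assoc, hDR] at this
    rw [Matrix.sub_mul, sub_eq_zero] at hDY
    rwa [← Matrix.mul_assoc, hDY, Matrix.mul_assoc]
  have h4 := pow_le_pow_left₀ (frobNorm_nonneg _) (hDmin _ hfeas) 2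
  rw [oracle_cost hS E hZ] at h4
  have h5 : frobNorm (regMap X0 * (Y * T)) ^ 2 ≤
      2 * (2 * c * d + frobNorm (augment X0 * T₀) ^ 2) * η := by
    -- Lower bound, optimality and oracle cost combined: `m d` cancels, and the factor `lam` divides
    -- out.
    have : lam * (1 / 2 * frobNorm (regMap X0 * (Y * T)) ^ 2 - 2 * η * c * d) ≤
        lam * (η * frobNorm (augment X0 * T₀) ^ 2) := by linarith
    have := le_of_mul_le_mul_left this hlam
    linarith
  intro u
  obtain ⟨w, rfl⟩ : ∃ w, u = T *ᵥ w := by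
    refine ⟨T⁻¹ *ᵥ u, ?_⟩
    rw [mulVec_mulVec, mul_nonsing_inv _ ((isUnit_iff_isUnit_det T).1 hTu), one_mulVec]
  have h6 := dotProduct_mulVec_self_le (regMap X0 * (Y * T)) w
  have h7 := dotProduct_transpose_mul_mul S (Y * T) w
  rw [hYT, one_mulVec] at h7
  rw [mulVec_mulVec w Y T, ← h7, mulVec_mulVec]
  refine h6.trans (mul_le_mul_of_nonneg_right ?_ (dotProduct_self_nonneg' w))
  nlinarith

theorem exists_tls_bound (hn : 1 ≤ n) (hS : S.PosSemidef)
    (hrank : (S * augment X0).rank = d) :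
    ∃ K η₀ : ℝ, 0 < K ∧ 0 < η₀ ∧ ∀ (m : ℕ) (A : Matrix (Fin m) (Fin n) ℝ)
      (E : Matrix (Fin m) (Fin n ⊕ Fin d) ℝ) (lam η : ℝ), 0 < lam → 0 < η → η ≤ η₀ →
      SmallError S A E lam η →
      (∃ X, IsTLSEstimate S (A * regMap X0 + E) X) ∧
      (∀ D Y, IsTLSPair S (A * regMap X0 + E) D Y → IsUnit Y.toRows₂) ∧
      ∀ X, IsTLSEstimate S (A * regMap X0 + E) X → ∀ i j, (X i j - X0 i j) ^ 2 ≤ K * η := by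
  obtain ⟨K, η₀, hK, hη₀, H⟩ := exists_regMap_mul_le (X0 := X0) hn hS hrank
  set s := frobNorm (psdSqrt S) ^ 2 + 1 with hs
  have hs0 : 0 < s := by positivity
  have hSv : ∀ v, v ⬝ᵥ S *ᵥ v ≤ s * (v ⬝ᵥ v) := by
    intro v
    rw [dotProduct_mulVec_psdSqrt hS]
    refine (dotProduct_mulVec_self_le _ v).trans ?_
    nlinarith [dotProduct_self_nonneg' v]
  refine ⟨2 * K * s * (2 * frobNorm X0 ^ 2 + 1), min η₀ (4 * K * s)⁻¹, by positivity,
    by positivity, ?_⟩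
  intro m A E lam η hlam hη hηle hE
  obtain ⟨⟨D₀, hD₀⟩, hpair⟩ := H m A E lam η hlam hη (hηle.trans (min_le_left _ _)) hE
  have hηs : K * η * s ≤ 1 / 4 := by
    have h1 := mul_le_mul_of_nonneg_left (hηle.trans (min_le_right _ _))
      (show 0 ≤ 4 * K * s by positivity)
    rw [mul_inv_cancel₀ (by positivity)] at h1
    linarith
  have hbound : ∀ D Y, IsTLSPair S (A * regMap X0 + E) D Y → ∀ u,
      regMap X0 *ᵥ (Y *ᵥ u) ⬝ᵥ regMap X0 *ᵥ (Y *ᵥ u) ≤ K * η * s * (Y *ᵥ u ⬝ᵥ Y *ᵥ u) := by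
    intro D Y hDY u
    refine (hpair D Y hDY u).trans ?_
    rw [mul_assoc (K * η)]
    exact mul_le_mul_of_nonneg_left (hSv _) (by positivity)
  -- If the lower block of `Yu` vanishes, then `P(Yu)` is the upper block and has the full norm of
  -- `Yu`. The bound with factor at most `1/4` leaves only `Yu = 0`.
  have hunit : ∀ D Y, IsTLSPair S (A * regMap X0 + E) D Y → IsUnit Y.toRows₂ := by
    intro D Y hDY
    rw [← mulVec_injective_iff_isUnit]
    refine (injective_iff_map_eq_zero Y.toRows₂.mulVecLin).2 fun u hu => ?_
    refine mulVec_eq_zero_of_rank_eq hDY.2.2 (dotProduct_self_eq_zero.1 ?_)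
    have h2 : (Y *ᵥ u) ∘ Sum.inr = 0 := hu
    have h3 : regMap X0 *ᵥ (Y *ᵥ u) = (Y *ᵥ u) ∘ Sum.inl := by
      rw [regMap, fromCols_mulVec, one_mulVec, h2, mulVec_zero, add_zero]
    have h4 : Y *ᵥ u ⬝ᵥ Y *ᵥ u = (Y *ᵥ u) ∘ Sum.inl ⬝ᵥ (Y *ᵥ u) ∘ Sum.inl := by
      rw [dotProduct, Fintype.sum_sum_type]
      have : ∀ i, (Y *ᵥ u) (Sum.inr i) = 0 := fun i => congrFun h2 i
      simp [this, dotProduct]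
    have h5 := hbound D Y hDY u
    rw [h3, ← h4] at h5
    have h6 := dotProduct_self_nonneg' (Y *ᵥ u)
    nlinarith
  refine ⟨?_, hunit, ?_⟩
  · obtain ⟨Y, hY, hYr⟩ := exists_mul_eq_zero_of_rank_le _ hD₀.1.2
    have hu := hunit D₀ Y ⟨hD₀, hY, hYr⟩
    have hdet := (isUnit_iff_isUnit_det _).1 hu
    refine ⟨-(Y.toRows₁ * Y.toRows₂⁻¹), D₀, hD₀, ?_⟩
    have : augment (-(Y.toRows₁ * Y.toRows₂⁻¹)) = -(Y * Y.toRows₂⁻¹) := by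
      conv_rhs => rw [← fromRows_toRows Y, fromRows_mul]
      rw [augment]
      simp only [fromRows_toRows]
      rw [mul_nonsing_inv _ hdet, fromRows_neg]
    rw [this, Matrix.mul_neg, ← Matrix.mul_assoc, hY, Matrix.zero_mul, neg_zero]
  · rintro X ⟨D, hD, hDX⟩ i j
    -- Applied to the `j`-th basis vector, with `a` and `b` the `j`-th columns of `X - X0` and `X0`.
    -- The right side contains `2|a|²` with factor at most `1/4`, which is absorbed on the left.
    have h1 := hbound D (augment X) ⟨hD, hDX, augment_rank X⟩ (Pi.single j 1)
    rw [mulVec_mulVec, regMap_mul_augment] at h1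
    set u : Fin d → ℝ := Pi.single j 1
    have hu : u ⬝ᵥ u = 1 := by simp [u]
    set a := (X - X0) *ᵥ u with ha
    set b := X0 *ᵥ u with hb
    have h2 : augment X *ᵥ u ⬝ᵥ augment X *ᵥ u = (a + b) ⬝ᵥ (a + b) + 1 := by
      have : a + b = X *ᵥ u := by rw [ha, hb, sub_mulVec, sub_add_cancel]
      rw [this, augment, fromRows_mulVec, sumElim_dotProduct_sumElim]
      simp [neg_mulVec, hu]
    have h3 : (a + b) ⬝ᵥ (a + b) ≤ 2 * (a ⬝ᵥ a) + 2 * (b ⬝ᵥ b) := by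
      have := dotProduct_self_nonneg' (a - b)
      rw [sub_dotProduct, dotProduct_sub, dotProduct_sub] at this
      rw [add_dotProduct, dotProduct_add, dotProduct_add]
      linarith
    have h4 : b ⬝ᵥ b ≤ frobNorm X0 ^ 2 := by
      have := dotProduct_mulVec_self_le X0 u
      rwa [hu, mul_one] at this
    have h5 : (X i j - X0 i j) ^ 2 ≤ a ⬝ᵥ a := by
      have : (X i j - X0 i j) = a i := by simp [ha, u]
      rw [this, sq]
      exact Finset.single_le_sum (f := fun i => a i * a i) (fun _ _ => mul_self_nonneg _)
        (Finset.mem_univ i)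
    refine h5.trans ?_
    rw [h2] at h1
    have hp : 0 < K * η * s := by positivity
    have ha0 := dotProduct_self_nonneg' a
    have h6 : K * η * s * ((a + b) ⬝ᵥ (a + b) + 1) ≤
        K * η * s * (2 * (a ⬝ᵥ a) + (2 * frobNorm X0 ^ 2 + 1)) :=
      mul_le_mul_of_nonneg_left (by linarith) hp.le
    have h7 : K * η * s * (a ⬝ᵥ a) ≤ 1 / 4 * (a ⬝ᵥ a) := mul_le_mul_of_nonneg_right hηs ha0
    nlinarith

end Deterministic

/-! ### Elementary inequalities for real powers -/

section RealInequalities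

/-- The tangent to the convex function `s ^ p` at `s = z` lies below its graph at `s = 1`; this is
Bernoulli's inequality at `1/z`. -/
theorem rpow_le_one_add_mul {z p : ℝ} (hz : 0 < z) (hp : 1 ≤ p) :
    z ^ p ≤ 1 + p * (z - 1) * z ^ (p - 1) := by
  have h1 : 1 + p * (z⁻¹ - 1) ≤ (1 + (z⁻¹ - 1)) ^ p :=
    one_add_mul_self_le_rpow_one_add (by linarith [inv_pos.2 hz]) hp
  rw [add_sub_cancel, Real.inv_rpow hz.le] at h1
  have hzp : 0 < z ^ p := Real.rpow_pos_of_pos hz p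
  have h2 := mul_le_mul_of_nonneg_left h1 hzp.le
  rw [mul_inv_cancel₀ hzp.ne'] at h2
  have h3 : z ^ p = z ^ (p - 1) * z := by
    rw [← Real.rpow_add_one hz.ne', sub_add_cancel]
  have h4 : z ^ p * (1 + p * (z⁻¹ - 1)) = z ^ p + p * (1 - z) * z ^ (p - 1) := by
    rw [h3]; field_simp
  linarith

theorem exists_abs_one_add_rpow_le {q : ℝ} (hq : 2 ≤ q) :
    ∃ c : ℝ, 1 ≤ c ∧ ∀ t : ℝ, |1 + t| ^ q ≤ 1 + q * t + c * (t ^ 2 + |t| ^ q) := by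
  -- For `|t| ≥ 1`, `2^q |t|^q` absorbs the left side and `q t²` a negative `q t`. For `|t| < 1` the
  -- second summand bounds the quadratic remainder.
  refine ⟨2 ^ q + q * ((q - 1) * 2 ^ q + 1), ?_, fun t => ?_⟩
  · have h1 : (0 : ℝ) < 2 ^ q := by positivity
    have : 0 ≤ (q - 1) * 2 ^ q := mul_nonneg (by linarith) h1.le
    nlinarith
  have h2q : (1 : ℝ) ≤ 2 ^ q := Real.one_le_rpow (by norm_num) (by linarith)
  have hq1 : 0 ≤ (q - 1) * 2 ^ q := mul_nonneg (by linarith) (by linarith)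
  have htq : 0 ≤ |t| ^ q := by positivity
  rcases le_or_gt 1 |t| with ht | ht
  · have h1 : |1 + t| ^ q ≤ 2 ^ q * |t| ^ q := by
      rw [← Real.mul_rpow (by norm_num) (abs_nonneg t)]
      refine Real.rpow_le_rpow (abs_nonneg _) ?_ (by linarith)
      calc |1 + t| ≤ |1| + |t| := abs_add_le _ _
        _ ≤ 2 * |t| := by rw [abs_one]; linarith
    have h2 : -t ≤ t ^ 2 := by
      rw [← sq_abs]; nlinarith [neg_abs_le t]
    have h3 : 0 ≤ q * ((q - 1) * 2 ^ q) * (t ^ 2 + |t| ^ q) := by positivity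
    nlinarith [mul_le_mul_of_nonneg_left h2 (show 0 ≤ q by linarith),
      mul_nonneg (show 0 ≤ q by linarith) htq, mul_nonneg (show (0 : ℝ) ≤ 2 ^ q by linarith)
      (sq_nonneg t)]
  · obtain ⟨ht1, ht2⟩ := abs_lt.1 ht
    have hz : 0 < 1 + t := by linarith
    rw [abs_of_pos hz]
    have h1 := rpow_le_one_add_mul hz (show 1 ≤ q by linarith)
    rw [add_sub_cancel_left] at h1
    have h2 : t * (1 + t) ^ (q - 1) ≤ t + ((q - 1) * 2 ^ q + 1) * t ^ 2 := by
      rcases le_total 0 t with h0 | h0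
      · have h3 := rpow_le_one_add_mul hz (show 1 ≤ q - 1 by linarith)
        rw [add_sub_cancel_left] at h3
        have h4 : (1 + t) ^ (q - 1 - 1) ≤ 2 ^ q :=
          (Real.rpow_le_rpow_of_exponent_le (by linarith) (by linarith)).trans
            (Real.rpow_le_rpow hz.le (by linarith) (by linarith))
        have h5 : (1 + t) ^ (q - 1) ≤ 1 + (q - 1) * 2 ^ q * t := by
          have := mul_le_mul_of_nonneg_left h4 (show 0 ≤ (q - 1) * t from
            mul_nonneg (by linarith) h0)
          linarith
        have := mul_le_mul_of_nonneg_left h5 h0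
        nlinarith [sq_nonneg t]
      · have h3 : 1 + (q - 1) * t ≤ (1 + t) ^ (q - 1) :=
          one_add_mul_self_le_rpow_one_add (by linarith) (by linarith)
        have := mul_le_mul_of_nonpos_left h3 h0
        have h6 : (q - 1) * t ^ 2 ≤ (q - 1) * 2 ^ q * t ^ 2 := by
          refine mul_le_mul_of_nonneg_right ?_ (sq_nonneg t)
          nlinarith
        nlinarith [sq_nonneg t]
    have h3 := mul_le_mul_of_nonneg_left h2 (show 0 ≤ q by linarith)
    have h4 : 0 ≤ (2 ^ q + q * ((q - 1) * 2 ^ q + 1)) * |t| ^ q :=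
      mul_nonneg (by nlinarith) htq
    have h5 : 0 ≤ 2 ^ q * t ^ 2 := by positivity
    nlinarith

/-- A second-order expansion of `|x + y| ^ q` around `x`. -/
theorem exists_abs_add_rpow_le {q : ℝ} (hq : 2 ≤ q) :
    ∃ c : ℝ, 1 ≤ c ∧ ∀ x y : ℝ, |x + y| ^ q ≤
      |x| ^ q + q * (|x| ^ (q - 2) * x * y) + c * (|x| ^ (q - 2) * y ^ 2 + |y| ^ q) := by
  obtain ⟨c, hc1, hc⟩ := exists_abs_one_add_rpow_le hq
  refine ⟨c, hc1, fun x y => ?_⟩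
  rcases eq_or_ne x 0 with rfl | hx
  · have h1 : 0 ≤ |(0 : ℝ)| ^ (q - 2) * y ^ 2 := by positivity
    have h2 : 0 ≤ |y| ^ q := by positivity
    have h3 : 0 ≤ |(0 : ℝ)| ^ q := by positivity
    rw [zero_add, mul_zero, zero_mul, mul_zero]
    nlinarith
  · have hx0 : 0 < |x| := abs_pos.2 hx
    have e1 : |x| ^ q = |x| ^ (q - 2) * x ^ 2 := by
      rw [← sq_abs x, ← Real.rpow_natCast, ← Real.rpow_add hx0]; norm_num
    have h := mul_le_mul_of_nonneg_left (hc (y / x)) (show 0 ≤ |x| ^ q by positivity)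
    have e2 : |x| ^ q * |1 + y / x| ^ q = |x + y| ^ q := by
      rw [← Real.mul_rpow (abs_nonneg _) (abs_nonneg _), ← abs_mul]
      congr 2; field_simp
    have e3 : |x| ^ q * |y / x| ^ q = |y| ^ q := by
      rw [← Real.mul_rpow (abs_nonneg _) (abs_nonneg _), ← abs_mul]
      congr 2; field_simp
    have e4 : |x| ^ q * (y / x) = |x| ^ (q - 2) * x * y := by
      rw [e1]; field_simp
    have e5 : |x| ^ q * (y / x) ^ 2 = |x| ^ (q - 2) * y ^ 2 := by
      rw [e1]; field_simp
    calc |x + y| ^ q = |x| ^ q * |1 + y / x| ^ q := e2.symm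
      _ ≤ _ := h
      _ = |x| ^ q + q * (|x| ^ q * (y / x)) + c * (|x| ^ q * (y / x) ^ 2 +
          |x| ^ q * |y / x| ^ q) := by ring
      _ = _ := by rw [e3, e4, e5]

/-- Split at `x² = b`. After integration this stands in for Lyapunov's inequality: if `E|x|^q ≤
b^{q/2}`, both terms contribute at most `b^{q/2-1}`. -/
theorem abs_rpow_sub_two_le {q b : ℝ} (hq : 2 ≤ q) (hb : 0 < b) (x : ℝ) :
    |x| ^ (q - 2) ≤ b ^ (q / 2 - 1) + b⁻¹ * |x| ^ q := by
  have h2 : 0 ≤ b⁻¹ * |x| ^ q := by positivity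
  have h3 : 0 ≤ b ^ (q / 2 - 1) := by positivity
  rcases le_or_gt (x ^ 2) b with h | h
  · have : |x| ^ (q - 2) ≤ b ^ (q / 2 - 1) := by
      have e : |x| ^ (q - 2) = (x ^ 2) ^ (q / 2 - 1) := by
        rw [← sq_abs, ← Real.rpow_natCast, ← Real.rpow_mul (abs_nonneg x)]
        congr 1; push_cast; ring
      rw [e]
      exact Real.rpow_le_rpow (sq_nonneg x) h (by linarith)
    linarith
  · have hx0 : 0 < |x| := by
      refine abs_pos.2 fun h0 => ?_
      rw [h0] at h; norm_num at h; linarith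
    have e1 : |x| ^ q = |x| ^ (q - 2) * x ^ 2 := by
      rw [← sq_abs x, ← Real.rpow_natCast, ← Real.rpow_add hx0]; norm_num
    have h4 : 0 ≤ |x| ^ (q - 2) := by positivity
    have : |x| ^ (q - 2) ≤ b⁻¹ * |x| ^ q := by
      rw [inv_mul_eq_div, le_div_iff₀ hb, e1]
      exact mul_le_mul_of_nonneg_left h.le h4
    linarith

theorem abs_rpow_le_one_add {p q : ℝ} (hp : 0 ≤ p) (hpq : p ≤ q) (x : ℝ) :
    |x| ^ p ≤ 1 + |x| ^ q := by
  rcases le_total |x| 1 with h | h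
  · have := Real.rpow_le_one (abs_nonneg x) h hp
    have : 0 ≤ |x| ^ q := by positivity
    linarith
  · have := Real.rpow_le_rpow_of_exponent_le h hpq
    linarith

theorem abs_add_rpow_le {q : ℝ} (hq : 0 ≤ q) (x y : ℝ) :
    |x + y| ^ q ≤ 2 ^ q * (|x| ^ q + |y| ^ q) := by
  have h : ∀ x y : ℝ, |x| ≤ |y| → |x + y| ^ q ≤ 2 ^ q * (|x| ^ q + |y| ^ q) := by
    intro x y hxy
    calc |x + y| ^ q ≤ (2 * |y|) ^ q :=
          Real.rpow_le_rpow (abs_nonneg _) ((abs_add_le x y).trans (by linarith)) hq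
      _ = 2 ^ q * |y| ^ q := Real.mul_rpow (by norm_num) (abs_nonneg y)
      _ ≤ _ := mul_le_mul_of_nonneg_left (le_add_of_nonneg_left (by positivity)) (by positivity)
  rcases le_total |x| |y| with hxy | hxy
  · exact h x y hxy
  · rw [add_comm x, add_comm (|x| ^ q)]
    exact h y x hxy

theorem abs_mul_rpow_le {q : ℝ} (hq : 0 ≤ q) (x y : ℝ) :
    |x * y| ^ q ≤ |x| ^ (2 * q) + |y| ^ (2 * q) := by
  have h : ∀ x y : ℝ, |x| ≤ |y| → |x * y| ^ q ≤ |y| ^ (2 * q) := by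
    intro x y hxy
    rw [Real.rpow_mul (abs_nonneg y)]
    refine Real.rpow_le_rpow (abs_nonneg _) ?_ hq
    rw [abs_mul, Real.rpow_two, sq]
    exact mul_le_mul_of_nonneg_right hxy (abs_nonneg y)
  have h1 : 0 ≤ |x| ^ (2 * q) := by positivity
  have h2 : 0 ≤ |y| ^ (2 * q) := by positivity
  rcases le_total |x| |y| with hxy | hxy
  · linarith [h x y hxy]
  · have := h y x hxy
    rw [mul_comm y] at this
    linarith

end RealInequalities

/-! ### Moments of sums of independent variables and Borel–Cantelli -/

section Moments

theorem integrable_abs_add_rpow {Ω : Type*} [MeasurableSpace Ω] {μ : Measure Ω} {f g : Ω → ℝ} {q : ℝ} (hf : Measurable f) (hg : Measurable g)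
    (hq : 0 ≤ q) (hfq : Integrable (fun ω => |f ω| ^ q) μ)
    (hgq : Integrable (fun ω => |g ω| ^ q) μ) :
    Integrable (fun ω => |f ω + g ω| ^ q) μ := by
  refine Integrable.mono' ((hfq.add hgq).const_mul (2 ^ q))
    ((hf.add hg).norm.pow_const q).aestronglyMeasurable (ae_of_all _ fun ω => ?_)
  rw [Real.norm_of_nonneg (by positivity)]
  exact abs_add_rpow_le hq _ _

variable {Ω : Type*} [MeasurableSpace Ω] {μ : Measure Ω} [IsProbabilityMeasure μ]

theorem integrable_abs_rpow_of_le {f : Ω → ℝ} {p q : ℝ} (hf : Measurable f) (hp : 0 ≤ p)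
    (hpq : p ≤ q) (hfq : Integrable (fun ω => |f ω| ^ q) μ) :
    Integrable (fun ω => |f ω| ^ p) μ := by
  refine Integrable.mono' ((integrable_const 1).add hfq)
    (hf.norm.pow_const p).aestronglyMeasurable (ae_of_all _ fun ω => ?_)
  rw [Real.norm_of_nonneg (by positivity)]
  exact abs_rpow_le_one_add hp hpq _

theorem integrable_of_abs_rpow {f : Ω → ℝ} {q : ℝ} (hf : Measurable f) (hq : 1 ≤ q)
    (hfq : Integrable (fun ω => |f ω| ^ q) μ) : Integrable f μ := by
  have := integrable_abs_rpow_of_le hf zero_le_one hq hfq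
  simp only [Real.rpow_one] at this
  exact (integrable_norm_iff hf.aestronglyMeasurable).1 this

/-- Integrate the second-order expansion of `|f + g|^q`. The first-order term vanishes because `g`
is centered and independent of `f`, and the second-order term factors. -/
theorem exists_integral_abs_add_rpow_le {q : ℝ} (hq : 2 ≤ q) :
    ∃ c : ℝ, 1 ≤ c ∧ ∀ f g : Ω → ℝ, Measurable f → Measurable g → IndepFun f g μ →
      Integrable (fun ω => |f ω| ^ q) μ → Integrable (fun ω => |g ω| ^ q) μ →
      ∫ ω, g ω ∂μ = 0 →
      ∫ ω, |f ω + g ω| ^ q ∂μ ≤ ∫ ω, |f ω| ^ q ∂μ +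
        c * ((∫ ω, |f ω| ^ (q - 2) ∂μ) * (∫ ω, g ω ^ 2 ∂μ) + ∫ ω, |g ω| ^ q ∂μ) := by
  obtain ⟨c, hc1, hc⟩ := exists_abs_add_rpow_le hq
  refine ⟨c, hc1, fun f g hf hg hfg hfq hgq hg0 => ?_⟩
  have hg1 : Integrable g μ := integrable_of_abs_rpow hg (by linarith) hgq
  have hg2 : Integrable (fun ω => g ω ^ 2) μ := by
    have := integrable_abs_rpow_of_le hg zero_le_two hq hgq
    simpa only [Real.rpow_two, sq_abs] using this
  have hf2 : Integrable (fun ω => |f ω| ^ (q - 2)) μ :=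
    integrable_abs_rpow_of_le hf (by linarith) (by linarith) hfq
  have hm1 : Measurable fun x : ℝ => |x| ^ (q - 2) := measurable_norm.pow_const _
  have hf3 : Integrable (fun ω => |f ω| ^ (q - 2) * f ω) μ := by
    refine Integrable.mono' (integrable_abs_rpow_of_le hf (p := q - 1) (by linarith)
      (by linarith) hfq) ((hm1.comp hf).mul hf).aestronglyMeasurable (ae_of_all _ fun ω => ?_)
    rw [norm_mul, Real.norm_of_nonneg (by positivity), Real.norm_eq_abs]
    rcases eq_or_ne (f ω) 0 with h0 | h0
    · rw [h0, abs_zero, mul_zero]; positivity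
    · rw [← Real.rpow_add_one (abs_pos.2 h0).ne']
      apply le_of_eq; congr 1; ring
  have i1 : IndepFun (fun ω => |f ω| ^ (q - 2) * f ω) g μ :=
    hfg.comp (hm1.mul measurable_id) measurable_id
  have i2 : IndepFun (fun ω => |f ω| ^ (q - 2)) (fun ω => g ω ^ 2) μ :=
    hfg.comp hm1 (measurable_id.pow_const 2)
  have I1 : Integrable (fun ω => |f ω| ^ (q - 2) * f ω * g ω) μ := i1.integrable_mul hf3 hg1
  have I2 : Integrable (fun ω => |f ω| ^ (q - 2) * g ω ^ 2) μ := i2.integrable_mul hf2 hg2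
  have e1 : ∫ ω, |f ω| ^ (q - 2) * f ω * g ω ∂μ = 0 := by
    have := i1.integral_fun_mul_eq_mul_integral hf3.aestronglyMeasurable hg1.aestronglyMeasurable
    rw [this, hg0, mul_zero]
  have e2 : ∫ ω, |f ω| ^ (q - 2) * g ω ^ 2 ∂μ =
      (∫ ω, |f ω| ^ (q - 2) ∂μ) * ∫ ω, g ω ^ 2 ∂μ :=
    i2.integral_fun_mul_eq_mul_integral hf2.aestronglyMeasurable hg2.aestronglyMeasurable
  have J1 : Integrable (fun ω => |f ω| ^ q + q * (|f ω| ^ (q - 2) * f ω * g ω)) μ :=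
    hfq.add (I1.const_mul q)
  have J2 : Integrable (fun ω => c * (|f ω| ^ (q - 2) * g ω ^ 2 + |g ω| ^ q)) μ :=
    (I2.add hgq).const_mul c
  calc ∫ ω, |f ω + g ω| ^ q ∂μ
      ≤ ∫ ω, (|f ω| ^ q + q * (|f ω| ^ (q - 2) * f ω * g ω) +
          c * (|f ω| ^ (q - 2) * g ω ^ 2 + |g ω| ^ q)) ∂μ :=
        integral_mono (integrable_abs_add_rpow hf hg (by linarith) hfq hgq)
          (J1.add J2) fun ω => hc _ _
    _ = _ := by
        rw [integral_add J1 J2,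
          integral_add hfq (I1.const_mul q), integral_const_mul, integral_const_mul,
          integral_add I2 hgq, e1, e2, mul_zero, add_zero]

/-- The induction step, with `t` the new squared weight. Average the lower bounds `b^p + (Bt)^p` and
`b^p + b^{p-1}Bt` of `(b + Bt)^p`, where `p = q/2`; `B ≥ 4c(1 + K)` lets half of each increment
absorb one error term. -/
theorem moment_step {q c K B b t : ℝ} (hq : 2 ≤ q) (hc : 1 ≤ c) (hK : 0 ≤ K)
    (hB : 4 * c * (1 + K) ≤ B) (hb : 1 ≤ b) (ht : 0 ≤ t) :
    b ^ (q / 2) + c * (2 * b ^ (q / 2 - 1) * (t * (1 + K)) + t ^ (q / 2) * K) ≤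
      (b + B * t) ^ (q / 2) := by
  set p := q / 2
  have hp : 1 ≤ p := by simp only [p]; linarith
  have hcK : 1 ≤ c * (1 + K) := by nlinarith
  have hB1 : 1 ≤ B := by linarith
  have hb0 : 0 < b := by linarith
  have hBt : 0 ≤ B * t := mul_nonneg (by linarith) ht
  have h1 : b ^ p + (B * t) ^ p ≤ (b + B * t) ^ p :=
    Real.add_rpow_le_rpow_add hb0.le hBt hp
  have h2 : b ^ p + b ^ (p - 1) * (B * t) ≤ (b + B * t) ^ p := by
    have h3 : 1 + p * (B * t / b) ≤ (1 + B * t / b) ^ p :=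
      one_add_mul_self_le_rpow_one_add (by linarith [div_nonneg hBt hb0.le]) hp
    have h4 : (b + B * t) ^ p = b ^ p * (1 + B * t / b) ^ p := by
      rw [← Real.mul_rpow hb0.le (by linarith [div_nonneg hBt hb0.le])]
      congr 1; field_simp
    have h5 : b ^ p = b ^ (p - 1) * b := by
      rw [← Real.rpow_add_one hb0.ne', sub_add_cancel]
    have hbp : 0 < b ^ p := by positivity
    have h6 : b ^ (p - 1) * (B * t) = b ^ p * (B * t / b) := by
      rw [h5]; field_simp
    have h7 : b ^ p * (B * t / b) ≤ b ^ p * (p * (B * t / b)) :=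
      mul_le_mul_of_nonneg_left (le_mul_of_one_le_left (div_nonneg hBt hb0.le) hp) hbp.le
    have h8 := mul_le_mul_of_nonneg_left h3 hbp.le
    rw [h4, h6]
    linarith
  have h3 : B * t ^ p ≤ (B * t) ^ p := by
    rw [Real.mul_rpow (by linarith) ht]
    refine mul_le_mul_of_nonneg_right ?_ (by positivity)
    conv_lhs => rw [← Real.rpow_one B]
    exact Real.rpow_le_rpow_of_exponent_le hB1 hp
  have h4 : 0 ≤ b ^ (p - 1) * t := by positivity
  have h5 : 0 ≤ t ^ p := by positivity
  have h6 := mul_le_mul_of_nonneg_right hB h4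
  have h7 := mul_le_mul_of_nonneg_right hB h5
  have h8 : 0 ≤ c * t ^ p := by positivity
  have h9 : 0 ≤ c * t ^ p * K := by positivity
  nlinarith

/-- A Marcinkiewicz-Zygmund type bound for weighted sums of independent centered variables. -/
theorem exists_integral_abs_sum_rpow_le {q K : ℝ} (hq : 2 ≤ q) (hK : 0 ≤ K)
    {ξ : ℕ → Ω → ℝ} (hm : ∀ i, Measurable (ξ i)) (hind : iIndepFun ξ μ)
    (h0 : ∀ i, ∫ ω, ξ i ω ∂μ = 0) (hi : ∀ i, Integrable (fun ω => |ξ i ω| ^ q) μ)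
    (hle : ∀ i, ∫ ω, |ξ i ω| ^ q ∂μ ≤ K) :
    ∃ B : ℝ, 0 < B ∧ ∀ (a : ℕ → ℝ) (m : ℕ),
      Integrable (fun ω => |∑ i ∈ Finset.range m, a i * ξ i ω| ^ q) μ ∧
      ∫ ω, |∑ i ∈ Finset.range m, a i * ξ i ω| ^ q ∂μ ≤
        (B * (1 + ∑ i ∈ Finset.range m, a i ^ 2)) ^ (q / 2) := by
  obtain ⟨c, hc1, hc⟩ := exists_integral_abs_add_rpow_le (μ := μ) hq
  have hB : 1 ≤ 4 * c * (1 + K) := by nlinarith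
  refine ⟨4 * c * (1 + K), by linarith, fun a m => ?_⟩
  set B := 4 * c * (1 + K) with hBdef
  induction m with
  | zero =>
    have : |(0 : ℝ)| ^ q = 0 := by rw [abs_zero, Real.zero_rpow (by linarith)]
    simp only [Finset.range_zero, Finset.sum_empty, this]
    exact ⟨integrable_zero _ _ _, by rw [integral_zero]; positivity⟩
  | succ m ih =>
    obtain ⟨ihi, ihb⟩ := ih
    set s := ∑ i ∈ Finset.range m, a i ^ 2
    have hs : 0 ≤ s := Finset.sum_nonneg fun _ _ => sq_nonneg _
    set f : Ω → ℝ := fun ω => ∑ i ∈ Finset.range m, a i * ξ i ω with hf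
    have hfm : Measurable f := Finset.measurable_sum _ fun i _ => (hm i).const_mul (a i)
    have hgm : Measurable fun ω => a m * ξ m ω := (hm m).const_mul (a m)
    have hga : ∀ ω, |a m * ξ m ω| ^ q = (a m ^ 2) ^ (q / 2) * |ξ m ω| ^ q := by
      intro ω
      rw [abs_mul, Real.mul_rpow (abs_nonneg _) (abs_nonneg _), ← sq_abs (a m),
        ← Real.rpow_natCast, ← Real.rpow_mul (abs_nonneg _)]
      congr 2; push_cast; ring
    have hgi : Integrable (fun ω => |a m * ξ m ω| ^ q) μ := by
      simp only [hga]; exact (hi m).const_mul _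
    have hfg : IndepFun f (fun ω => a m * ξ m ω) μ := by
      have h1 : iIndepFun (fun i ω => a i * ξ i ω) μ :=
        hind.comp (fun i x => a i * x) fun i => measurable_const_mul (a i)
      have h2 := h1.indepFun_finsetSum_of_notMem (fun i => (hm i).const_mul (a i))
        (Finset.notMem_range_self (n := m))
      convert h2 using 1
      ext ω; simp [hf]
    have key := hc f _ hfm hgm hfg ihi hgi (by rw [integral_const_mul, h0, mul_zero])
    simp only [Finset.sum_range_succ]
    refine ⟨integrable_abs_add_rpow hfm hgm (by linarith) ihi hgi, key.trans ?_⟩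
    -- The summand `1` keeps `b` positive even if all earlier weights vanish.
    have hb : 1 ≤ B * (1 + s) := by nlinarith
    set b := B * (1 + s)
    have k1 : ∫ ω, |f ω| ^ (q - 2) ∂μ ≤ 2 * b ^ (q / 2 - 1) := by
      calc ∫ ω, |f ω| ^ (q - 2) ∂μ ≤ ∫ ω, (b ^ (q / 2 - 1) + b⁻¹ * |f ω| ^ q) ∂μ :=
            integral_mono (integrable_abs_rpow_of_le hfm (by linarith) (by linarith) ihi)
              ((integrable_const _).add (ihi.const_mul _))
              fun ω => abs_rpow_sub_two_le hq (by linarith) _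
        _ = b ^ (q / 2 - 1) + b⁻¹ * ∫ ω, |f ω| ^ q ∂μ := by
            rw [integral_add (integrable_const _) (ihi.const_mul _), integral_const_mul]
            simp [hf]
        _ ≤ b ^ (q / 2 - 1) + b⁻¹ * b ^ (q / 2) := by
            have : 0 ≤ b⁻¹ := inv_nonneg.2 (by linarith)
            gcongr
        _ = 2 * b ^ (q / 2 - 1) := by
            rw [Real.rpow_sub_one (by linarith)]; field_simp; ring
    have k2 : ∫ ω, (a m * ξ m ω) ^ 2 ∂μ ≤ a m ^ 2 * (1 + K) := by
      have e : ∀ ω, (a m * ξ m ω) ^ 2 = a m ^ 2 * |ξ m ω| ^ (2 : ℝ) := by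
        intro ω; rw [Real.rpow_two, sq_abs, mul_pow]
      simp only [e]
      rw [integral_const_mul]
      refine mul_le_mul_of_nonneg_left ?_ (sq_nonneg _)
      calc ∫ ω, |ξ m ω| ^ (2 : ℝ) ∂μ ≤ ∫ ω, (1 + |ξ m ω| ^ q) ∂μ :=
            integral_mono (integrable_abs_rpow_of_le (hm m) zero_le_two hq (hi m))
              ((integrable_const _).add (hi m)) fun ω => abs_rpow_le_one_add zero_le_two hq _
        _ = 1 + ∫ ω, |ξ m ω| ^ q ∂μ := by
            rw [integral_add (integrable_const _) (hi m)]; simp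
        _ ≤ 1 + K := by linarith [hle m]
    have k3 : ∫ ω, |a m * ξ m ω| ^ q ∂μ ≤ (a m ^ 2) ^ (q / 2) * K := by
      simp only [hga]
      rw [integral_const_mul]
      exact mul_le_mul_of_nonneg_left (hle m) (by positivity)
    have k4 : 0 ≤ ∫ ω, (a m * ξ m ω) ^ 2 ∂μ := integral_nonneg fun _ => sq_nonneg _
    have k5 : 0 ≤ 2 * b ^ (q / 2 - 1) := by
      have : 0 ≤ b := by linarith
      positivity
    have k6 := mul_le_mul k1 k2 k4 k5
    have k7 := moment_step hq hc1 hK hBdef.symm.le hb (sq_nonneg (a m))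
    have e : B * (1 + (s + a m ^ 2)) = b + B * a m ^ 2 := by simp only [b]; ring
    rw [e]
    refine le_trans ?_ k7
    have : 0 ≤ c := by linarith
    gcongr

/-- Markov's inequality for the `q`-th power, then Borel–Cantelli. The weights are extended reals so
that the series of the theorem can be used as it stands. -/
theorem ae_eventually_abs_lt {q D : ℝ} (hq : 0 < q) {X : ℕ → Ω → ℝ} {w : ℕ → ENNReal} {τ : ℕ → ℝ}
    (hw : ∑' k, w k ≠ ⊤) (hτ : ∀ k, 0 < τ k)
    (hi : ∀ k, Integrable (fun ω => |X k ω| ^ q) μ)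
    (hX : ∀ k, ENNReal.ofReal (∫ ω, |X k ω| ^ q ∂μ) ≤ ENNReal.ofReal (D * τ k ^ q) * w k) :
    ∀ᵐ ω ∂μ, ∀ᶠ k in atTop, |X k ω| < τ k := by
  have hset : ∀ k, μ {ω | τ k ≤ |X k ω|} ≤ ENNReal.ofReal D * w k := by
    intro k
    have hτq : 0 < τ k ^ q := Real.rpow_pos_of_pos (hτ k) q
    have h1 := mul_meas_ge_le_integral_of_nonneg (μ := μ)
      (ae_of_all _ fun ω => (show 0 ≤ |X k ω| ^ q by positivity)) (hi k) (τ k ^ q)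
    have h2 : {ω | τ k ≤ |X k ω|} ⊆ {ω | τ k ^ q ≤ |X k ω| ^ q} :=
      fun ω hω => Real.rpow_le_rpow (hτ k).le hω hq.le
    have h3 : ENNReal.ofReal (τ k ^ q) * μ {ω | τ k ^ q ≤ |X k ω| ^ q} ≤
        ENNReal.ofReal (∫ ω, |X k ω| ^ q ∂μ) := by
      have := ENNReal.ofReal_le_ofReal h1
      rwa [ENNReal.ofReal_mul hτq.le, ofReal_measureReal] at this
    have h4 : ENNReal.ofReal (τ k ^ q) * μ {ω | τ k ≤ |X k ω|} ≤
        ENNReal.ofReal (τ k ^ q) * (ENNReal.ofReal D * w k) := by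
      refine ((mul_le_mul_right (measure_mono h2) _).trans h3).trans ((hX k).trans (le_of_eq ?_))
      rw [mul_comm D, ENNReal.ofReal_mul hτq.le, mul_assoc]
    exact (ENNReal.mul_le_mul_iff_right (ENNReal.ofReal_pos.2 hτq).ne' ENNReal.ofReal_ne_top).1 h4
  have hsum : ∑' k, μ {ω | τ k ≤ |X k ω|} ≠ ⊤ := by
    refine ne_top_of_le_ne_top ?_ (ENNReal.tsum_le_tsum hset)
    rw [ENNReal.tsum_mul_left]
    exact ENNReal.mul_ne_top ENNReal.ofReal_ne_top hw
  filter_upwards [ae_eventually_notMem hsum] with ω hω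
  filter_upwards [hω] with k hk
  simpa using hk

end Moments

/-! ### Almost sure smallness of the errors -/

section Consistency

open Matrix

variable {n d : ℕ}

theorem abs_dotProduct_mulVec_le {k : Type*} [Fintype k] {H : Matrix k k ℝ} {ε : ℝ}
    (hH : ∀ i j, |H i j| ≤ ε) (v : k → ℝ) :
    |v ⬝ᵥ H *ᵥ v| ≤ Fintype.card k * ε * (v ⬝ᵥ v) := by
  have h1 : v ⬝ᵥ H *ᵥ v = ∑ i, ∑ j, v i * (H i j * v j) := by
    simp only [dotProduct, mulVec, Finset.mul_sum]
  have h2 : ∀ i j, |v i * (H i j * v j)| ≤ ε * ((v i ^ 2 + v j ^ 2) / 2) := by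
    intro i j
    have : |v i| * |v j| ≤ (v i ^ 2 + v j ^ 2) / 2 := by
      rw [← sq_abs (v i), ← sq_abs (v j)]
      nlinarith [sq_nonneg (|v i| - |v j|)]
    rw [abs_mul, abs_mul]
    calc |v i| * (|H i j| * |v j|) = |H i j| * (|v i| * |v j|) := by ring
      _ ≤ _ := mul_le_mul (hH i j) this (by positivity) ((abs_nonneg _).trans (hH i j))
  have h3 : v ⬝ᵥ v = ∑ i, v i ^ 2 := by simp only [dotProduct, sq]
  rw [h1]
  calc |∑ i, ∑ j, v i * (H i j * v j)| ≤ ∑ i, ∑ j, |v i * (H i j * v j)| :=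
        (Finset.abs_sum_le_sum_abs _ _).trans
          (Finset.sum_le_sum fun i _ => Finset.abs_sum_le_sum_abs _ _)
    _ ≤ ∑ i, ∑ j, ε * ((v i ^ 2 + v j ^ 2) / 2) :=
        Finset.sum_le_sum fun i _ => Finset.sum_le_sum fun j _ => h2 i j
    _ = _ := by
        simp only [← Finset.mul_sum, ← Finset.sum_div, Finset.sum_add_distrib, Finset.sum_const,
          Finset.card_univ, nsmul_eq_mul, h3]
        ring

/-- The Gram condition needs only the factor `n + d`, and the cross condition only `√(n(n + d))`;
since `n ≥ 1`, `n(n + d)` covers both. The factor `U` reduces the cross condition, stated for all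
`x`, to finitely many entries. -/
theorem smallError_of_entries {m : ℕ} (hn : 1 ≤ n)
    {S : Matrix (Fin n ⊕ Fin d) (Fin n ⊕ Fin d) ℝ} {A U : Matrix (Fin m) (Fin n) ℝ}
    {V : Matrix (Fin n) (Fin n) ℝ} {E : Matrix (Fin m) (Fin n ⊕ Fin d) ℝ} {ε : ℝ} (hε : 0 ≤ ε)
    (hlam : 0 < lambdaMin (Aᵀ * A)) (hU : Uᵀ * U = 1) (hA : A = U * V)
    (hgram : ∀ i j, |(Eᵀ * E - (m : ℝ) • S) i j| ≤ ε * lambdaMin (Aᵀ * A))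
    (hcross : ∀ i j, |(Uᵀ * E) i j| ≤ ε * √(lambdaMin (Aᵀ * A))) :
    SmallError S A E (lambdaMin (Aᵀ * A)) (n * (n + d) * ε) := by
  set lam := lambdaMin (Aᵀ * A) with hlamdef
  have hn' : (1 : ℝ) ≤ n := by exact_mod_cast hn
  refine ⟨fun x => ?_, fun v => ?_, fun x => ?_⟩
  · rw [← dotProduct_transpose_mul_self]
    refine lambdaMin_mul_dotProduct_le ?_ x
    rw [IsHermitian, conjTranspose_eq_transpose_of_trivial, transpose_mul, transpose_transpose]
  · have h := abs_dotProduct_mulVec_le hgram v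
    rw [sub_mulVec, dotProduct_sub, dotProduct_transpose_mul_self, smul_mulVec, dotProduct_smul,
      smul_eq_mul, Fintype.card_sum, Fintype.card_fin, Fintype.card_fin] at h
    refine h.trans ?_
    have h2 : 0 ≤ ((n : ℝ) + d) * ε * lam * (v ⬝ᵥ v) := by
      have := dotProduct_self_nonneg' v
      positivity
    push_cast
    nlinarith
  · have h1 : A *ᵥ x ⬝ᵥ A *ᵥ x = V *ᵥ x ⬝ᵥ V *ᵥ x := by
      rw [hA, ← mulVec_mulVec, ← dotProduct_transpose_mul_self, hU, one_mulVec]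
    have h2 : Eᵀ *ᵥ (A *ᵥ x) = (Uᵀ * E)ᵀ *ᵥ (V *ᵥ x) := by
      rw [hA, ← mulVec_mulVec, transpose_mul, transpose_transpose, mulVec_mulVec _ Eᵀ]
    rw [h1, h2]
    refine (dotProduct_mulVec_self_le _ _).trans
      (mul_le_mul_of_nonneg_right ?_ (dotProduct_self_nonneg' _))
    rw [frobNorm, Real.sq_sqrt (by positivity)]
    have h3 : ∀ i j, (Uᵀ * E)ᵀ i j ^ 2 ≤ ε ^ 2 * lam := by
      intro i j
      rw [transpose_apply, ← sq_abs, ← Real.sq_sqrt hlam.le, ← mul_pow]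
      exact pow_le_pow_left₀ (abs_nonneg _) (hcross j i) 2
    calc ∑ i, ∑ j, (Uᵀ * E)ᵀ i j ^ 2 ≤ ∑ _i : Fin n ⊕ Fin d, ∑ _j : Fin n, ε ^ 2 * lam :=
          Finset.sum_le_sum fun i _ => Finset.sum_le_sum fun j _ => h3 i j
      _ = (n * (n + d)) * (ε ^ 2 * lam) := by
          simp only [Finset.sum_const, Finset.card_univ, Fintype.card_sum, Fintype.card_fin,
            nsmul_eq_mul]
          push_cast; ring
      _ ≤ (n * (n + d)) ^ 2 * (ε ^ 2 * lam) := by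
          refine mul_le_mul_of_nonneg_right ?_ (by positivity)
          have hd : (0 : ℝ) ≤ d := Nat.cast_nonneg d
          have hnd : (1 : ℝ) ≤ n * (n + d) := by nlinarith
          exact le_self_pow₀ hnd two_ne_zero
      _ = _ := by ring

/-- The matrix of the first `m` error vectors. -/
def errE {Ω : Type*} (δ : ℕ → Ω → (Fin n ⊕ Fin d) → ℝ) (m : ℕ) (ω : Ω) :
    Matrix (Fin m) (Fin n ⊕ Fin d) ℝ :=
  Matrix.of fun i : Fin m => δ i ω

variable {Ω : Type*} [MeasurableSpace Ω] {μ : Measure Ω}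
  {S : Matrix (Fin n ⊕ Fin d) (Fin n ⊕ Fin d) ℝ} {δ : ℕ → Ω → (Fin n ⊕ Fin d) → ℝ}

theorem exists_integrable_moment {r : ℝ} (hmeas : ∀ i, Measurable (δ i))
    (hmoment : ∃ K : NNReal, ∀ i j,
      ∫⁻ ω, ENNReal.ofReal (|δ i ω j| ^ (2 * r)) ∂μ ≤ (K : ENNReal)) :
    ∃ K : ℝ, 0 ≤ K ∧ ∀ i j, Integrable (fun ω => |δ i ω j| ^ (2 * r)) μ ∧
      ∫ ω, |δ i ω j| ^ (2 * r) ∂μ ≤ K := by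
  obtain ⟨K, hK⟩ := hmoment
  refine ⟨K, K.2, fun i j => ?_⟩
  have hm : Measurable fun ω => |δ i ω j| ^ (2 * r) :=
    ((measurable_pi_iff.1 (hmeas i) j).norm).pow_const _
  have hnn : ∀ ω, 0 ≤ |δ i ω j| ^ (2 * r) := fun ω => by positivity
  constructor
  · refine ⟨hm.aestronglyMeasurable, ?_⟩
    rw [hasFiniteIntegral_iff_ofReal (ae_of_all _ hnn)]
    exact (hK i j).trans_lt ENNReal.coe_lt_top
  · rw [integral_eq_lintegral_of_nonneg_ae (ae_of_all _ hnn) hm.aestronglyMeasurable]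
    exact ENNReal.toReal_le_of_le_ofReal K.2 (by simpa using hK i j)

theorem integrable_mul_of_moment {r : ℝ} (hr : 2 ≤ r) {f g : Ω → ℝ} (hf : Measurable f)
    (hg : Measurable g) (hfi : Integrable (fun ω => |f ω| ^ (2 * r)) μ)
    (hgi : Integrable (fun ω => |g ω| ^ (2 * r)) μ) :
    Integrable (fun ω => |f ω * g ω| ^ r) μ ∧
      ∫ ω, |f ω * g ω| ^ r ∂μ ≤ ∫ ω, |f ω| ^ (2 * r) ∂μ + ∫ ω, |g ω| ^ (2 * r) ∂μ := by
  have h : Integrable (fun ω => |f ω * g ω| ^ r) μ := by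
    refine Integrable.mono' (hfi.add hgi) ((hf.mul hg).norm.pow_const r).aestronglyMeasurable
      (ae_of_all _ fun ω => ?_)
    rw [Real.norm_of_nonneg (by positivity)]
    exact abs_mul_rpow_le (by linarith) _ _
  refine ⟨h, ?_⟩
  rw [← integral_add hfi hgi]
  exact integral_mono h (hfi.add hgi) fun ω => abs_mul_rpow_le (by linarith) _ _

/-- `vᵀSv` is the second moment of `v ⬝ᵥ δ 0`. -/
theorem posSemidef_of_covariance (hint : ∀ j k, Integrable (fun ω => δ 0 ω j * δ 0 ω k) μ)
    (hcov : ∀ j k, ∫ ω, δ 0 ω j * δ 0 ω k ∂μ = S j k) : S.PosSemidef := by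
  refine PosSemidef.of_dotProduct_mulVec_nonneg ?_ fun v => ?_
  · ext j k
    rw [conjTranspose_apply, star_trivial, ← hcov, ← hcov]
    simp only [mul_comm]
  · rw [star_trivial]
    have h : v ⬝ᵥ S *ᵥ v = ∫ ω, (v ⬝ᵥ δ 0 ω) ^ 2 ∂μ := by
      have e : ∀ ω, (v ⬝ᵥ δ 0 ω) ^ 2 = ∑ j, ∑ k, v j * v k * (δ 0 ω j * δ 0 ω k) := by
        intro ω
        rw [sq, dotProduct, Finset.sum_mul_sum]
        exact Finset.sum_congr rfl fun j _ => Finset.sum_congr rfl fun k _ => by ring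
      simp only [e]
      rw [integral_finsetSum _ fun j _ => integrable_finsetSum _ fun k _ =>
        (hint j k).const_mul _]
      simp only [dotProduct, mulVec, Finset.mul_sum]
      refine Finset.sum_congr rfl fun j _ => ?_
      rw [integral_finsetSum _ fun k _ => (hint j k).const_mul _]
      refine Finset.sum_congr rfl fun k _ => ?_
      rw [integral_const_mul, hcov]; ring
    rw [h]
    exact integral_nonneg fun ω => sq_nonneg _

theorem ofReal_ratio_rpow {r x y : ℝ} (hx : 0 < x) (hy : 0 < y) :
    (ENNReal.ofReal x / ENNReal.ofReal y) ^ r = ENNReal.ofReal ((x / y) ^ r) := by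
  rw [← ENNReal.ofReal_div_of_pos hy, ENNReal.ofReal_rpow_of_pos (div_pos hx hy)]

variable [IsProbabilityMeasure μ]

theorem ae_eventually_gram_lt (hmeas : ∀ i, Measurable (δ i)) (hindep : iIndepFun δ μ)
    (hcov : ∀ i j k, ∫ ω, δ i ω j * δ i ω k ∂μ = S j k) {r : ℝ} (hr : 2 ≤ r) {m₀ : ℕ}
    (hm₀ : 1 ≤ m₀) {K : ℝ} (hK0 : 0 ≤ K)
    (hK : ∀ i j, Integrable (fun ω => |δ i ω j| ^ (2 * r)) μ ∧
      ∫ ω, |δ i ω j| ^ (2 * r) ∂μ ≤ K) {lam : ℕ → ℝ} (hlam : ∀ k, 0 < lam k)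
    (hsum : ∑' k : ℕ, (ENNReal.ofReal √((m₀ + k : ℕ) : ℝ) / ENNReal.ofReal (lam k)) ^ r ≠ ⊤)
    {ε : ℝ} (hε : 0 < ε) (j l : Fin n ⊕ Fin d) :
    ∀ᵐ ω ∂μ, ∀ᶠ k in atTop, |((errE δ (m₀ + k) ω)ᵀ * errE δ (m₀ + k) ω -
      ((m₀ + k : ℕ) : ℝ) • S) j l| < ε * lam k := by
  have hδ : ∀ i j, Measurable fun ω => δ i ω j := fun i j => measurable_pi_iff.1 (hmeas i) j
  have hprod := fun i => integrable_mul_of_moment hr (hδ i j) (hδ i l) (hK i j).1 (hK i l).1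
  have hpm : ∀ i, Measurable fun ω => δ i ω j * δ i ω l := fun i => (hδ i j).mul (hδ i l)
  have hpi : ∀ i, Integrable (fun ω => δ i ω j * δ i ω l) μ := fun i =>
    integrable_of_abs_rpow (hpm i) (by linarith) (hprod i).1
  have hci : Integrable (fun _ : Ω => |-S j l| ^ r) μ := integrable_const _
  have hxi : ∀ i, Integrable (fun ω => |δ i ω j * δ i ω l + -S j l| ^ r) μ := fun i =>
    integrable_abs_add_rpow (hpm i) measurable_const (by linarith) (hprod i).1 hci
  obtain ⟨B, hB0, hB⟩ := exists_integral_abs_sum_rpow_le (μ := μ) (q := r)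
    (K := 2 ^ r * (K + K + |-S j l| ^ r)) hr (by positivity)
    (ξ := fun i ω => δ i ω j * δ i ω l + -S j l) (fun i => (hpm i).add_const _)
    (hindep.comp (fun _ x => x j * x l + -S j l) fun _ =>
      ((measurable_pi_apply j).mul (measurable_pi_apply l)).add_const _)
    (fun i => by rw [integral_add (hpi i) (integrable_const _), hcov]; simp) hxi
    (fun i => by
      calc ∫ ω, |δ i ω j * δ i ω l + -S j l| ^ r ∂μ
          ≤ ∫ ω, 2 ^ r * (|δ i ω j * δ i ω l| ^ r + |-S j l| ^ r) ∂μ :=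
            integral_mono (hxi i) (((hprod i).1.add hci).const_mul _)
              fun ω => abs_add_rpow_le (by linarith) _ _
        _ = 2 ^ r * (∫ ω, |δ i ω j * δ i ω l| ^ r ∂μ + |-S j l| ^ r) := by
            rw [integral_const_mul, integral_add (hprod i).1 hci]; simp
        _ ≤ _ := by
            have := (hprod i).2
            have h1 := (hK i j).2
            have h2 := (hK i l).2
            gcongr
            linarith)
  have hX : ∀ k ω, ((errE δ (m₀ + k) ω)ᵀ * errE δ (m₀ + k) ω - ((m₀ + k : ℕ) : ℝ) • S) j l =
      ∑ i ∈ Finset.range (m₀ + k), 1 * (δ i ω j * δ i ω l + -S j l) := by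
    intro k ω
    rw [Matrix.sub_apply, mul_apply, Matrix.smul_apply, Finset.sum_range]
    simp only [one_mul, Finset.sum_add_distrib, Finset.sum_const, Finset.card_univ,
      Fintype.card_fin, nsmul_eq_mul, smul_eq_mul]
    simp only [errE, transpose_apply, of_apply]
    ring
  simp only [hX]
  -- `D` comes from `(B(1 + m))^{r/2} ≤ (2Bm)^{r/2}`, valid since `m ≥ 1`, divided by the `ε^r` of
  -- the threshold.
  refine ae_eventually_abs_lt (q := r) (D := (2 * B) ^ (r / 2) / ε ^ r) (by linarith) hsum
    (fun k => mul_pos hε (hlam k)) (fun k => (hB (fun _ => 1) (m₀ + k)).1) fun k => ?_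
  have hmk : (1 : ℝ) ≤ ((m₀ + k : ℕ) : ℝ) := by exact_mod_cast hm₀.trans (Nat.le_add_right _ _)
  set M : ℝ := ((m₀ + k : ℕ) : ℝ) with hM
  have hM0 : 0 < M := by linarith
  have hlk := hlam k
  rw [ofReal_ratio_rpow (Real.sqrt_pos.2 hM0) hlk, ← ENNReal.ofReal_mul (by positivity)]
  refine ENNReal.ofReal_le_ofReal ((hB (fun _ => 1) (m₀ + k)).2.trans ?_)
  have e1 : ∑ i ∈ Finset.range (m₀ + k), (1 : ℝ) ^ 2 = M := by simp [hM]
  have e2 : (2 * B) ^ (r / 2) / ε ^ r * (ε * lam k) ^ r * (√M / lam k) ^ r =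
      (2 * B * M) ^ (r / 2) := by
    rw [Real.mul_rpow hε.le hlk.le, Real.div_rpow (Real.sqrt_nonneg _) hlk.le,
      Real.mul_rpow (by positivity) hM0.le, Real.sqrt_eq_rpow, ← Real.rpow_mul hM0.le]
    have h1 : 0 < ε ^ r := by positivity
    have h2 : 0 < lam k ^ r := by positivity
    rw [show 1 / 2 * r = r / 2 by ring]
    field_simp
  rw [e1, e2]
  refine Real.rpow_le_rpow (by positivity) ?_ (by linarith)
  nlinarith

theorem ae_eventually_cross_lt (hmeas : ∀ i, Measurable (δ i)) (hindep : iIndepFun δ μ)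
    (hmean : ∀ i j, ∫ ω, δ i ω j ∂μ = 0) {r : ℝ} (hr : 2 ≤ r) {m₀ : ℕ}
    (hm₀ : 1 ≤ m₀) {K : ℝ} (hK0 : 0 ≤ K)
    (hK : ∀ i j, Integrable (fun ω => |δ i ω j| ^ (2 * r)) μ ∧
      ∫ ω, |δ i ω j| ^ (2 * r) ∂μ ≤ K) {lam : ℕ → ℝ} (hlam : ∀ k, 0 < lam k)
    (hsum : ∑' k : ℕ, (ENNReal.ofReal √((m₀ + k : ℕ) : ℝ) / ENNReal.ofReal (lam k)) ^ r ≠ ⊤)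
    {U : (k : ℕ) → Matrix (Fin (m₀ + k)) (Fin n) ℝ} (hU : ∀ k, (U k)ᵀ * U k = 1)
    {ε : ℝ} (hε : 0 < ε) (l : Fin n) (j : Fin n ⊕ Fin d) :
    ∀ᵐ ω ∂μ, ∀ᶠ k in atTop, |((U k)ᵀ * errE δ (m₀ + k) ω) l j| < ε * √(lam k) := by
  have hδ : ∀ i j, Measurable fun ω => δ i ω j := fun i j => measurable_pi_iff.1 (hmeas i) j
  obtain ⟨B, hB0, hB⟩ := exists_integral_abs_sum_rpow_le (μ := μ) (q := 2 * r)
    (ξ := fun i ω => δ i ω j) (by linarith) hK0 (fun i => hδ i j)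
    (hindep.comp (fun _ x => x j) fun _ => measurable_pi_apply j) (fun i => hmean i j)
    (fun i => (hK i j).1) (fun i => (hK i j).2)
  -- Column `l` of `U k`, extended by zero. The weights change with `k`, so it matters that `B` does
  -- not depend on them.
  let a : ℕ → ℕ → ℝ := fun k i => if h : i < m₀ + k then U k ⟨i, h⟩ l else 0
  have ha : ∀ k (i : Fin (m₀ + k)), a k i = U k i l := fun k i => by simp [a]
  have hX : ∀ k ω, ((U k)ᵀ * errE δ (m₀ + k) ω) l j =
      ∑ i ∈ Finset.range (m₀ + k), a k i * δ i ω j := by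
    intro k ω
    rw [mul_apply, Finset.sum_range]
    simp only [ha, errE, transpose_apply, of_apply]
  have ha2 : ∀ k, ∑ i ∈ Finset.range (m₀ + k), a k i ^ 2 = 1 := by
    intro k
    have := congrFun (congrFun (hU k) l) l
    rw [one_apply_eq, mul_apply] at this
    rw [Finset.sum_range, ← this]
    simp only [ha, transpose_apply, sq]
  simp only [hX]
  -- The weights have unit length, so the `2r`-th moment is at most `(2B)^r`. The factor `√m ≥ 1` in
  -- the series is not needed here and is simply inserted.
  refine ae_eventually_abs_lt (q := 2 * r) (D := (2 * B) ^ r / (ε ^ 2) ^ r) (by linarith) hsum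
    (fun k => mul_pos hε (Real.sqrt_pos.2 (hlam k))) (fun k => (hB (a k) (m₀ + k)).1) fun k => ?_
  have hmk : (1 : ℝ) ≤ ((m₀ + k : ℕ) : ℝ) := by exact_mod_cast hm₀.trans (Nat.le_add_right _ _)
  set M : ℝ := ((m₀ + k : ℕ) : ℝ) with hM
  have hM0 : 0 < M := by linarith
  have hlk := hlam k
  rw [ofReal_ratio_rpow (Real.sqrt_pos.2 hM0) hlk, ← ENNReal.ofReal_mul (by positivity)]
  refine ENNReal.ofReal_le_ofReal ((hB (a k) (m₀ + k)).2.trans ?_)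
  have e2 : (2 * B) ^ r / (ε ^ 2) ^ r * (ε * √(lam k)) ^ (2 * r) * (√M / lam k) ^ r =
      (2 * B * √M) ^ r := by
    rw [Real.rpow_mul (by positivity), Real.rpow_two, mul_pow, Real.sq_sqrt hlk.le,
      Real.mul_rpow (by positivity) hlk.le, Real.div_rpow (Real.sqrt_nonneg _) hlk.le,
      Real.mul_rpow (by positivity) (Real.sqrt_nonneg _)]
    have h1 : 0 < (ε ^ 2) ^ r := by positivity
    have h2 : 0 < lam k ^ r := by positivity
    field_simp
  rw [ha2, e2, show 2 * r / 2 = r by ring]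
  refine Real.rpow_le_rpow (by positivity) ?_ (by linarith)
  have : 1 ≤ √M := Real.one_le_sqrt.2 hmk
  nlinarith

theorem lambdaMin_gram_nonneg {m : ℕ} (hn : 1 ≤ n) (A : Matrix (Fin m) (Fin n) ℝ) :
    0 ≤ lambdaMin (Aᵀ * A) := by
  have hP : (Aᵀ * A).PosSemidef := by
    simpa [conjTranspose_eq_transpose_of_trivial] using posSemidef_conjTranspose_mul_self A
  have : Nonempty (Fin n) := ⟨⟨0, hn⟩⟩
  rw [lambdaMin, hP.isHermitian.spectrum_real_eq_range_eigenvalues]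
  refine le_csInf (Set.range_nonempty _) ?_
  rintro _ ⟨i, rfl⟩
  exact hP.eigenvalues_nonneg i

theorem exists_isometry_factor {m : ℕ} {A : Matrix (Fin m) (Fin n) ℝ}
    (hlam : 0 < lambdaMin (Aᵀ * A)) :
    ∃ (U : Matrix (Fin m) (Fin n) ℝ) (V : Matrix (Fin n) (Fin n) ℝ), Uᵀ * U = 1 ∧ A = U * V := by
  have hH : (Aᵀ * A).IsHermitian := by
    rw [IsHermitian, conjTranspose_eq_transpose_of_trivial, transpose_mul, transpose_transpose]
  have hP : (Aᵀ * A).PosDef := by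
    refine PosDef.of_dotProduct_mulVec_pos hH fun v hv => ?_
    rw [star_trivial]
    refine lt_of_lt_of_le (mul_pos hlam ?_) (lambdaMin_mul_dotProduct_le hH v)
    exact lt_of_le_of_ne (dotProduct_self_nonneg' v) fun h => hv (dotProduct_self_eq_zero.1 h.symm)
  obtain ⟨T, hTs, hTu, hT⟩ := hP.exists_normalizer
  refine ⟨A * T, T⁻¹, ?_, ?_⟩
  · rw [transpose_mul, hTs, ← hT]; simp only [Matrix.mul_assoc]
  · rw [Matrix.mul_assoc, mul_nonsing_inv _ ((isUnit_iff_isUnit_det T).1 hTu), Matrix.mul_one]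

theorem ae_eventually_smallError (hn : 1 ≤ n) (a0 : ℕ → Fin n → ℝ)
    (hmeas : ∀ i, Measurable (δ i)) (hindep : iIndepFun δ μ)
    (hmean : ∀ i j, ∫ ω, δ i ω j ∂μ = 0)
    (hcov : ∀ i j k, ∫ ω, δ i ω j * δ i ω k ∂μ = S j k) {r : ℝ} (hr : 2 ≤ r) {m₀ : ℕ}
    (hm₀ : 1 ≤ m₀) {K : ℝ} (hK0 : 0 ≤ K)
    (hK : ∀ i j, Integrable (fun ω => |δ i ω j| ^ (2 * r)) μ ∧
      ∫ ω, |δ i ω j| ^ (2 * r) ∂μ ≤ K)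
    (hlam : ∀ k, 0 < lambdaMin ((trueA a0 (m₀ + k))ᵀ * trueA a0 (m₀ + k)))
    (hsum : ∑' k : ℕ, (ENNReal.ofReal √((m₀ + k : ℕ) : ℝ) /
      ENNReal.ofReal (lambdaMin ((trueA a0 (m₀ + k))ᵀ * trueA a0 (m₀ + k)))) ^ r ≠ ⊤)
    {η : ℝ} (hη : 0 < η) :
    ∀ᵐ ω ∂μ, ∀ᶠ k in atTop, SmallError S (trueA a0 (m₀ + k)) (errE δ (m₀ + k) ω)
      (lambdaMin ((trueA a0 (m₀ + k))ᵀ * trueA a0 (m₀ + k))) η := by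
  have hn0 : (0 : ℝ) < n := by exact_mod_cast hn
  have hnd : (0 : ℝ) < n * (n + d) := by positivity
  choose U V hU hV using fun k => exists_isometry_factor (hlam k)
  have hε : 0 < η / (n * (n + d)) := div_pos hη hnd
  have h1 := ae_all_iff.2 fun j => ae_all_iff.2 fun l =>
    ae_eventually_gram_lt hmeas hindep hcov hr hm₀ hK0 hK hlam hsum hε j l
  have h2 := ae_all_iff.2 fun l => ae_all_iff.2 fun j =>
    ae_eventually_cross_lt hmeas hindep hmean hr hm₀ hK0 hK hlam hsum hU hε l j
  filter_upwards [h1, h2] with ω hω1 hω2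
  filter_upwards [eventually_all.2 fun j => eventually_all.2 fun l => hω1 j l,
    eventually_all.2 fun l => eventually_all.2 fun j => hω2 l j] with k hk1 hk2
  have := smallError_of_entries hn hε.le (hlam k) (hU k) (hV k) (fun j l => (hk1 j l).le)
    (fun l j => (hk2 l j).le)
  rwa [mul_div_cancel₀ _ hnd.ne'] at this

theorem lambdaMin_pos_of_tsum_ne_top (hn : 1 ≤ n) (a0 : ℕ → Fin n → ℝ) {r : ℝ} (hr : 2 ≤ r)
    {m₀ : ℕ} (hm₀ : 1 ≤ m₀)
    (hsum : ∑' k : ℕ, (ENNReal.ofReal √((m₀ + k : ℕ) : ℝ) /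
      ENNReal.ofReal (lambdaMin ((trueA a0 (m₀ + k))ᵀ * trueA a0 (m₀ + k)))) ^ r ≠ ⊤) (k : ℕ) :
    0 < lambdaMin ((trueA a0 (m₀ + k))ᵀ * trueA a0 (m₀ + k)) := by
  refine lt_of_le_of_ne (lambdaMin_gram_nonneg hn _) fun h => ?_
  have hk := ENNReal.ne_top_of_tsum_ne_top hsum k
  -- The numerator must be positive: `0 / 0` is `0` in `ENNReal`, and only then would a zero
  -- eigenvalue go unnoticed.
  have hM : (0 : ℝ) < ((m₀ + k : ℕ) : ℝ) := by exact_mod_cast by omega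
  rw [← h, ENNReal.ofReal_zero, ENNReal.div_zero
    (ENNReal.ofReal_pos.2 (Real.sqrt_pos.2 hM)).ne', ENNReal.top_rpow_of_pos (by linarith)] at hk
  exact hk rfl

end Consistency
-- Strong consistency
theorem mainTheorem2 {Ω : Type*} [MeasurableSpace Ω] (μ : Measure Ω) [IsProbabilityMeasure μ]
    {n d : ℕ} (hn : 1 ≤ n)
    (a0 : ℕ → Fin n → ℝ) (X0 : Matrix (Fin n) (Fin d) ℝ)
    (S : Matrix (Fin n ⊕ Fin d) (Fin n ⊕ Fin d) ℝ)
    (δ : ℕ → Ω → (Fin n ⊕ Fin d) → ℝ)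
    (hmeas : ∀ i, Measurable (δ i))
    (hindep : iIndepFun δ μ)
    (hmean : ∀ i j, ∫ ω, δ i ω j ∂μ = 0)
    (hcov : ∀ i j k, ∫ ω, δ i ω j * δ i ω k ∂μ = S j k)
    (hrank : (S * augment X0).rank = d)
    (r : ℝ) (hr : 2 ≤ r) (m₀ : ℕ) (hm₀ : 1 ≤ m₀)
    (hmoment : ∃ K : NNReal, ∀ i j,
      ∫⁻ ω, ENNReal.ofReal (|δ i ω j| ^ (2 * r)) ∂μ ≤ (K : ENNReal))
    -- the sum is taken in `[0, ∞]`, so that a term with `lambdaMin = 0` is infinite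
    (hsum : (∑' k : ℕ, (ENNReal.ofReal √((m₀ + k : ℕ) : ℝ) /
      ENNReal.ofReal (lambdaMin ((trueA a0 (m₀ + k)).transpose * trueA a0 (m₀ + k)))) ^ r) < ⊤) :
    ∀ᵐ ω ∂μ,
      (∀ᶠ m in atTop,
        (∃ X, IsTLSEstimate S (obsC a0 X0 δ m ω) X) ∧
        ∀ Δ Y, IsTLSPair S (obsC a0 X0 δ m ω) Δ Y → IsUnit Y.toRows₂) ∧
      ∀ Xhat : ℕ → Matrix (Fin n) (Fin d) ℝ,
        (∀ᶠ m in atTop, IsTLSEstimate S (obsC a0 X0 δ m ω) (Xhat m)) →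
          Tendsto Xhat atTop (𝓝 X0) := by
  obtain ⟨K, hK0, hK⟩ := exists_integrable_moment hmeas hmoment
  have hδ : ∀ i j, Measurable fun ω => δ i ω j := fun i j => measurable_pi_iff.1 (hmeas i) j
  have hS : S.PosSemidef := by
    refine posSemidef_of_covariance (μ := μ) (δ := δ) (fun j k => ?_) (hcov 0)
    exact integrable_of_abs_rpow ((hδ 0 j).mul (hδ 0 k)) (by linarith)
      (integrable_mul_of_moment hr (hδ 0 j) (hδ 0 k) (hK 0 j).1 (hK 0 k).1).1
  have hlam := lambdaMin_pos_of_tsum_ne_top hn a0 hr hm₀ hsum.ne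
  obtain ⟨c, η₀, hc, hη₀, H⟩ := exists_tls_bound (X0 := X0) hn hS hrank
  have hobs : ∀ m ω, obsC a0 X0 δ m ω = trueA a0 m * regMap X0 + errE δ m ω := fun m ω => by
    rw [obsC, trueC_eq, errE]
  -- Countably many levels `η₀ / (N + 1)` give a single null set outside which every level is
  -- eventually reached.
  have hsmall := ae_all_iff.2 fun N : ℕ =>
    ae_eventually_smallError (η := η₀ / (N + 1)) hn a0 hmeas hindep hmean hcov hr hm₀ hK0 hK hlam
      hsum.ne (by positivity)
  filter_upwards [hsmall] with ω hω
  have hbound : ∀ N : ℕ, ∀ᶠ m in atTop,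
      ((∃ X, IsTLSEstimate S (obsC a0 X0 δ m ω) X) ∧
        ∀ Δ Y, IsTLSPair S (obsC a0 X0 δ m ω) Δ Y → IsUnit Y.toRows₂) ∧
      ∀ X, IsTLSEstimate S (obsC a0 X0 δ m ω) X → ∀ i j,
        (X i j - X0 i j) ^ 2 ≤ c * (η₀ / (N + 1)) := by
    intro N
    obtain ⟨k₀, hk₀⟩ := eventually_atTop.1 (hω N)
    filter_upwards [eventually_ge_atTop (m₀ + k₀)] with m hm
    obtain ⟨k, rfl⟩ := Nat.exists_eq_add_of_le ((Nat.le_add_right m₀ k₀).trans hm)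
    obtain ⟨h1, h2, h3⟩ := H _ _ _ _ _ (hlam k) (by positivity)
      (div_le_self hη₀.le (by linarith [Nat.cast_nonneg (α := ℝ) N])) (hk₀ k (by omega))
    rw [hobs]
    exact ⟨⟨h1, h2⟩, h3⟩
  refine ⟨(hbound 0).mono fun m h => h.1, fun Xhat hX => ?_⟩
  refine tendsto_pi_nhds.2 fun i => tendsto_pi_nhds.2 fun j => ?_
  rw [Metric.tendsto_atTop']
  intro ε hε
  obtain ⟨N, hN⟩ := exists_nat_gt (c * η₀ / ε ^ 2)
  obtain ⟨m₁, hm₁⟩ := eventually_atTop.1 ((hbound N).and hX)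
  refine ⟨m₁, fun m hm => ?_⟩
  obtain ⟨⟨_, h⟩, hXm⟩ := hm₁ m hm.le
  have h1 := h _ hXm i j
  rw [Real.dist_eq]
  refine abs_lt_of_sq_lt_sq (h1.trans_lt ?_) hε.le
  rw [← mul_div_assoc, div_lt_iff₀ (by positivity)]
  rw [div_lt_iff₀ (by positivity)] at hN
  nlinarith [sq_pos_of_pos hε]
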